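/- **Setting.** Let $\phi_1,\dots,\phi_n\in\mathbb R^d$ be fixed feature vectors and let $\Phi\in\mathbb R^{n\times d}$ be the matrix with rows $\phi_i^\top$. For $k\le n$ let $\mathcal W_k$ be the set of diagonal $n\times n$ matrices with diagonal entries in $\{0,1\}$ and trace $k$, and put $\psi^-(k)=\min_{W\in\mathcal W_k}\sigma_{\min}(\Phi^\top W\Phi)$, $\psi^+(k)=\max_{W\in\mathcal W_k}\sigma_{\max}(\Phi^\top W\Phi)$. For constants $c_0,A,B>0$, $\Phi$ is *regular* if $An\le\psi^-(\lfloor\beta n\rfloor)\le Bn$ and $An\le\psi^+(\lfloor\beta n\rfloor)\le Bn$ for all $\beta\in[c_0,1]$. Let $\omega:\mathbb R\to\mathbb R$ be monotone and differentiable with $\omega'(u)\in[a,b]$ for all $u$, where $0<a\le b$. Let $S^\star\subseteq\{1,\dots,n\}$ be the set of clean samples, $\alpha^\star=|S^\star|/n$, and $\theta^\star\in\mathbb R^d$. The outputs are $y_i=\omega(\phi_i^\top\theta^\star)+e_i$ for $i\in S^\star$ and $y_i=r_i+e_i$ for $i\notin S^\star$, where $e_1,\dots,e_n$ are independent and sub-Gaussian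 with parameter $\sigma^2$, i.e. $\mathbb E\,e^{te_i}\le e^{\sigma^2t^2/2}$ for all $t$, with $\sigma\ge 0$. With $f_\theta(\phi_i,y_i)=(y_i-\omega(\phi_i^\top\theta))^2$, one round of iterative trimmed loss minimization with fraction $\alpha$ and step size $\eta>0$ maps the current iterate $\theta_t$ to $$\theta_{t+1}=\theta_t-\frac{\eta}{|S_t|}\sum_{i\in S_t}\nabla_\theta f_{\theta_t}(\phi_i,y_i),\qquad S_t\in\arg\min_{|S|=\lfloor\alpha n\rfloor}\ \sum_{i\in S}f_{\theta_t}(\phi_i,y_i).$$ Put $\xi_t=\sqrt{\sum_{i=1}^n\|\phi_i\|_2^2\log n}$, and consider the bound $$\|\theta^\star-\theta_{t+1}\|_2\le\bigl(1-c_1\eta(a^2-\kappa_tb^2)\bigr)\|\theta_t-\theta^\star\|_2+c_2\,b\sqrt{\kappa_t}\,\sigma+\frac{\eta\, b\,\xi_t}{n}\,\sigma.\qquad(*)$$ **Theorem.** Given regularity constants $c_0,A,B>0$ and $\alpha\in[c_0,1)$, there are constants $c_{\mathrm{th}}<1$ and $c_1,c_2>0$, depending only on $c_0,A,B,\alpha$,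 such that the following two statements hold whenever $\Phi$ is regular with constants $c_0,A,B$, $\alpha<\alpha^\star$ and $\alpha^\star>c_{\mathrm{th}}$. 1. *(Arbitrary outputs.)* There is $K>0$ depending only on $c_0,A,B,\alpha$, and for all $0<a\le b$ there is $\eta_0>0$ depending only on $c_0,A,B,\alpha,a,b$, such that if $n\ge1$, $n\ge K\,d\log d$ and $0<\eta\le\eta_0$, then with probability at least $1-K/n$ over the noise the following holds simultaneously for all $r\in\mathbb R^n$, all $\theta_t\in\mathbb R^d$ and all minimizers $S_t$: the bound $(*)$ holds for some $\kappa_t\in[0,\tfrac12]$. 2. *(Random outputs.)* Suppose that the $r_i$, $i\notin S^\star$, are sub-Gaussian after centring, with laws that have densities bounded by $L$, and that they and $e_1,\dots,e_n$ are all independent. For all $L,a>0$ there is $c>0$ depending only on $c_0,A,B,\alpha,L,a$; for every $b\ge a$ there is $K>0$ depending only on these quantities and $b$; and for every $\sigma\ge0$ there is $\eta_0>0$ depending only on these quantities and $\sigma$; such that if $n\ge1$, $n\ge K\,d\log d$ and $0<\eta\le\eta_0$, then with probability at least $1-K/n$ the following holds simultaneously for all $\theta_t\in\mathbb R^d$ and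 all minimizers $S_t$: the bound $(*)$ holds for some $\kappa_t\ge0$ with $$\kappa_t\le c\,\max\Bigl\{\frac ba\sqrt{\|\theta_t-\theta^\star\|_2^2+\sigma^2},\ \frac{\log n}{n}\Bigr\}.$$ -/

import Mathlib

open MeasureTheory ProbabilityTheory
open scoped NNReal

noncomputable section

namespace ITLM

/-- The set `𝒲_k` of diagonal `n × n` matrices with diagonal entries in `{0, 1}` and trace `k`. -/
def selectionMatrices (n k : ℕ) : Set (Matrix (Fin n) (Fin n) ℝ) :=
  {W | (∀ i j, i ≠ j → W i j = 0) ∧ (∀ i, W i i = 0 ∨ W i i = 1) ∧ W.trace = (k : ℝ)}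

/-- Largest singular value of a square matrix (Mathlib lists singular values in
decreasing order, starting at index `0`). -/
def sigmaMax {d : ℕ} (M : Matrix (Fin d) (Fin d) ℝ) : ℝ :=
  (Matrix.toEuclideanLin M).singularValues 0

/-- Smallest of the `d` singular values of a `d × d` matrix. -/
def sigmaMin {d : ℕ} (M : Matrix (Fin d) (Fin d) ℝ) : ℝ :=
  (Matrix.toEuclideanLin M).singularValues (d - 1)

/-- The `n × d` feature matrix, whose `i`-th row is the feature vector `φ(x_i)`. -/
def featureMatrix {n d : ℕ} (phi : Fin n → EuclideanSpace ℝ (Fin d)) :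
    Matrix (Fin n) (Fin d) ℝ :=
  Matrix.of fun i j => phi i j

/-- `ψ⁻(k)`: minimum over `W ∈ 𝒲_k` of `σ_min (Φᵀ W Φ)` (a minimum over a finite set). -/
def psiMinus {n d : ℕ} (phi : Fin n → EuclideanSpace ℝ (Fin d)) (k : ℕ) : ℝ :=
  sInf ((fun W => sigmaMin ((featureMatrix phi).transpose * W * featureMatrix phi)) ''
    selectionMatrices n k)

/-- `ψ⁺(k)`: maximum over `W ∈ 𝒲_k` of `σ_max (Φᵀ W Φ)` (a maximum over a finite set). -/
def psiPlus {n d : ℕ} (phi : Fin n → EuclideanSpace ℝ (Fin d)) (k : ℕ) : ℝ :=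
  sSup ((fun W => sigmaMax ((featureMatrix phi).transpose * W * featureMatrix phi)) ''
    selectionMatrices n k)

/-- Regular feature matrix with constants `c₀, A, B`: for every fraction `β ∈ [c₀, 1]` and
`k = ⌊β n⌋`, both `ψ⁻(k)` and `ψ⁺(k)` lie between `A n` and `B n`, i.e. are `Θ(n)`. -/
def IsRegular {n d : ℕ} (c₀ A B : ℝ) (phi : Fin n → EuclideanSpace ℝ (Fin d)) : Prop :=
  ∀ β : ℝ, c₀ ≤ β → β ≤ 1 →
    psiMinus phi ⌊β * n⌋₊ ∈ Set.Icc (A * n) (B * n) ∧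
    psiPlus phi ⌊β * n⌋₊ ∈ Set.Icc (A * n) (B * n)

/-- Link functions: monotone, differentiable, with derivative in `[a, b]` everywhere. -/
def IsLink (a b : ℝ) (link : ℝ → ℝ) : Prop :=
  Monotone link ∧ Differentiable ℝ link ∧ ∀ u, deriv link u ∈ Set.Icc a b

/-- Squared loss `f_θ(x, y) = (y - ω(φ(x)ᵀ θ))²` of a sample with feature vector `v = φ(x)`. -/
def sqLoss {d : ℕ} (link : ℝ → ℝ) (v : EuclideanSpace ℝ (Fin d)) (y : ℝ)
    (θ : EuclideanSpace ℝ (Fin d)) : ℝ :=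
  (y - link (inner ℝ v θ)) ^ 2

/-- Outputs: `ω(φ(x_i)ᵀ θ⋆) + e_i` for the clean samples `i ∈ Sstar`, and `r_i + e_i` for the
bad ones. -/
def output {n d : ℕ} (link : ℝ → ℝ) (phi : Fin n → EuclideanSpace ℝ (Fin d))
    (Sstar : Finset (Fin n)) (θstar : EuclideanSpace ℝ (Fin d)) (r e : Fin n → ℝ) :
    Fin n → ℝ :=
  fun i => (if i ∈ Sstar then link (inner ℝ (phi i) θstar) else r i) + e i

/-- `S` is a possible outcome of the selection step at the iterate `θ`: it has `⌊α n⌋` elements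
and minimizes the total loss among all sets with that many elements. -/
def IsTrimmedSet {n d : ℕ} (link : ℝ → ℝ) (phi : Fin n → EuclideanSpace ℝ (Fin d))
    (y : Fin n → ℝ) (α : ℝ) (θ : EuclideanSpace ℝ (Fin d)) (S : Finset (Fin n)) : Prop :=
  S.card = ⌊α * n⌋₊ ∧
    ∀ S' : Finset (Fin n), S'.card = ⌊α * n⌋₊ →
      ∑ i ∈ S, sqLoss link (phi i) (y i) θ ≤ ∑ i ∈ S', sqLoss link (phi i) (y i) θ

/-- The model update with one gradient step on the full batch `S` (`M = 1`, `N = |S|`):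
`θ - η (1/|S|) ∑_{i ∈ S} ∇_θ f_θ(s_i)`. -/
def modelUpdate {n d : ℕ} (link : ℝ → ℝ) (phi : Fin n → EuclideanSpace ℝ (Fin d))
    (y : Fin n → ℝ) (η : ℝ) (S : Finset (Fin n)) (θ : EuclideanSpace ℝ (Fin d)) :
    EuclideanSpace ℝ (Fin d) :=
  θ - η • ((S.card : ℝ)⁻¹ • ∑ i ∈ S, gradient (sqLoss link (phi i) (y i)) θ)

/-- `ξ = √(∑ᵢ ‖φ(x_i)‖² log n)`. -/
def xi {n d : ℕ} (phi : Fin n → EuclideanSpace ℝ (Fin d)) : ℝ :=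
  √(∑ i, ‖phi i‖ ^ 2 * Real.log n)

/-- The fraction of clean samples. -/
def cleanFraction {n : ℕ} (Sstar : Finset (Fin n)) : ℝ := (Sstar.card : ℝ) / n

/-- Random noise: independent, measurable, and sub-Gaussian with parameter `σ²`
(so in particular centred). -/
def IsNoise {Ω : Type*} [MeasurableSpace Ω] {n : ℕ} (σ : ℝ≥0) (e : Fin n → Ω → ℝ)
    (μ : Measure Ω) : Prop :=
  (∀ i, Measurable (e i)) ∧ iIndepFun e μ ∧ ∀ i, HasSubgaussianMGF (e i) (σ ^ 2) μ

/-- Random outputs of the bad samples: each `r_i`, `i ∉ Sstar`, is measurable, sub-Gaussian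
(after centring), its law has a density bounded by `L` (written through intervals), and these
`r_i` together with all the noise variables are independent. -/
def IsRandomOutput {Ω : Type*} [MeasurableSpace Ω] {n : ℕ} (L : ℝ) (Sstar : Finset (Fin n))
    (r e : Fin n → Ω → ℝ) (μ : Measure Ω) : Prop :=
  (∀ i, i ∉ Sstar → Measurable (r i) ∧
    (∃ s : ℝ≥0, HasSubgaussianMGF (fun w => r i w - ∫ w', r i w' ∂μ) s μ) ∧
    ∀ u v : ℝ, u ≤ v → μ (r i ⁻¹' Set.Icc u v) ≤ ENNReal.ofReal (L * (v - u))) ∧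
  iIndepFun (fun j : Fin n ⊕ {i : Fin n // i ∉ Sstar} =>
    Sum.elim e (fun i => r i.1) j) μ

/-- The one-step error bound, from the iterate `θ` to the next iterate `θ'`, with the value `κ`. -/
def StepBound {n d : ℕ} (phi : Fin n → EuclideanSpace ℝ (Fin d))
    (c₁ c₂ a b η σ κ : ℝ) (θstar θ θ' : EuclideanSpace ℝ (Fin d)) : Prop :=
  ‖θstar - θ'‖ ≤ (1 - c₁ * η * (a ^ 2 - κ * b ^ 2)) * ‖θ - θstar‖
    + c₂ * b * √κ * σ + η * b * xi phi / n * σ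

end ITLM

end

/-! With Δ = θ - θ⋆, the mean value theorem splits one update into Δ minus a weighted Gram matrix of
the selected clean samples applied to Δ (weights in [a², b²]), plus a noise term, plus the
contribution of the selected bad samples. Regularity gives the quadratic form over the selected
clean samples a lower bound of order n, even after removing the few bad ones, so the first part
contracts by 1 - ηa²D with D = A²/(2B) (`norm_sub_smul_gram_le`). Taking c₁ = D/2 leaves room for
errors.

The noise enters only through ∑ eᵢ² ≤ 9nσ², which Chebyshev's inequality gives with probability at
least 1 - 96/n. By Cauchy–Schwarz its contribution is of order ηbσ. The term c₂b√κσ has no factor η,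
so a small step size hides it there.

For the bad samples, a fixed fraction of the samples is clean and unselected, and each of these has
loss at least that of any selected sample. Averaging bounds every selected residual by T = C(b‖Δ‖ +
σ) (`abs_residual_le`). For arbitrary outputs, Cauchy–Schwarz over at most εn bad samples gives a
factor √(εB), small enough for κ = 1/2.

For random outputs, a bad sample can be selected only if its output lies within T of the prediction,
which has probability at most 2LT by the density bound. Hoeffding's inequality for sums weighted by
|⟨φᵢ, u⟩|, with a union bound over a grid of iterates and directions, makes this uniform
(`measure_uniform_indicator_bound`, `norm_bad_sum_le_of_grid`). The grid count is beaten by the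
exponential bound when n ≥ K d log d (`exists_forall_card_mul_exp_le`). The bad part is then at most
n b T times a multiple of T plus a small constant. The multiple of T becomes κ; the constant is
absorbed by the spare contraction. -/

namespace ITLM

/-! ### Singular values, Gram matrices and quadratic forms of subsamples. -/

section SingularValues

variable {E : Type*} [NormedAddCommGroup E] [InnerProductSpace ℝ E]

theorem norm_sq_eq_sum_repr {d : ℕ} (b : OrthonormalBasis (Fin d) ℝ E) (u : E) :
    ‖u‖ ^ 2 = ∑ i, (b.repr u i) ^ 2 := by
  rw [← b.repr.norm_map, EuclideanSpace.norm_sq_eq]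
  simp

variable [FiniteDimensional ℝ E]

theorem norm_sq_eq_sum_singularValues (T : E →ₗ[ℝ] E) {d : ℕ} (hd : Module.finrank ℝ E = d)
    (u : E) : ‖T u‖ ^ 2 = ∑ i : Fin d, T.singularValues i ^ 2 *
      ((T.isSymmetric_adjoint_comp_self.eigenvectorBasis hd).repr u i) ^ 2 := by
  have h1 : ‖T u‖ ^ 2 = inner ℝ u ((LinearMap.adjoint T ∘ₗ T) u) := by
    rw [LinearMap.comp_apply, LinearMap.adjoint_inner_right, real_inner_self_eq_norm_sq]
  rw [h1, ← (T.isSymmetric_adjoint_comp_self.eigenvectorBasis hd).repr.inner_map_map,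
    PiLp.inner_apply]
  refine Finset.sum_congr rfl fun i _ => ?_
  rw [LinearMap.IsSymmetric.eigenvectorBasis_apply_self_apply, T.sq_singularValues_fin hd]
  simp
  ring

theorem norm_le_singularValues_zero (T : E →ₗ[ℝ] E) (u : E) :
    ‖T u‖ ≤ T.singularValues 0 * ‖u‖ := by
  refine abs_le_of_sq_le_sq' ?_ (mul_nonneg (T.singularValues_nonneg 0) (norm_nonneg u)) |>.2
  rw [mul_pow, norm_sq_eq_sum_singularValues T rfl,
    norm_sq_eq_sum_repr (T.isSymmetric_adjoint_comp_self.eigenvectorBasis rfl) u, Finset.mul_sum]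
  refine Finset.sum_le_sum fun i _ => ?_
  gcongr
  · exact T.singularValues_nonneg _
  · exact T.singularValues_antitone (Nat.zero_le _)

theorem singularValues_last_mul_norm_le (T : E →ₗ[ℝ] E) {d : ℕ} (hd : Module.finrank ℝ E = d)
    (u : E) : T.singularValues (d - 1) * ‖u‖ ≤ ‖T u‖ := by
  refine abs_le_of_sq_le_sq' ?_ (norm_nonneg _) |>.2
  rw [mul_pow, norm_sq_eq_sum_singularValues T hd,
    norm_sq_eq_sum_repr (T.isSymmetric_adjoint_comp_self.eigenvectorBasis hd) u, Finset.mul_sum]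
  refine Finset.sum_le_sum fun i _ => ?_
  gcongr
  · exact T.singularValues_nonneg _
  · exact T.singularValues_antitone (by omega)

end SingularValues

/-- The `0`-`1` diagonal matrix selecting the rows in `S`. -/
noncomputable def selector {n : ℕ} (S : Finset (Fin n)) : Matrix (Fin n) (Fin n) ℝ :=
  Matrix.diagonal fun i => if i ∈ S then 1 else 0

theorem selector_mem {n : ℕ} (S : Finset (Fin n)) : selector S ∈ selectionMatrices n S.card := by
  refine ⟨fun i j h => by simp [selector, h], fun i => ?_, ?_⟩
  · by_cases h : i ∈ S <;> simp [selector, h]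
  · simp [selector, Matrix.trace]

theorem selectionMatrices_finite (n k : ℕ) : (selectionMatrices n k).Finite := by
  refine (Set.finite_range (selector (n := n))).subset ?_
  rintro W ⟨h1, h2, -⟩
  refine ⟨Finset.univ.filter fun i => W i i = 1, ?_⟩
  ext i j
  by_cases hij : i = j
  · subst hij
    rcases h2 i with h | h <;> simp [selector, h]
  · simp [selector, hij, h1 i j hij]

theorem toEuclideanLin_gram {n d : ℕ} (phi : Fin n → EuclideanSpace ℝ (Fin d))
    (S : Finset (Fin n)) (u : EuclideanSpace ℝ (Fin d)) :
    Matrix.toEuclideanLin ((featureMatrix phi).transpose * selector S * featureMatrix phi) u =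
      ∑ i ∈ S, inner ℝ (phi i) u • phi i := by
  ext j
  simp only [Matrix.toEuclideanLin, selector, featureMatrix, Matrix.toLpLin_apply]
  rw [← Matrix.mulVec_mulVec, ← Matrix.mulVec_mulVec]
  simp only [Matrix.mulVec, dotProduct, Matrix.diagonal_apply, Matrix.transpose_apply,
    Matrix.of_apply, WithLp.ofLp_sum, Finset.sum_apply, WithLp.ofLp_smul, Pi.smul_apply,
    smul_eq_mul, PiLp.inner_apply]
  simp only [ite_mul, zero_mul, one_mul, Finset.sum_ite_eq, Finset.mem_univ, if_true, mul_ite,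
    mul_zero]
  rw [Finset.sum_ite_mem, Finset.univ_inter]
  refine Finset.sum_congr rfl fun i _ => ?_
  rw [mul_comm]
  congr 1
  refine Finset.sum_congr rfl fun l _ => ?_
  simp [mul_comm]

variable {n d : ℕ} {phi : Fin n → EuclideanSpace ℝ (Fin d)}

theorem psiMinus_le (S : Finset (Fin n)) (u : EuclideanSpace ℝ (Fin d)) :
    psiMinus phi S.card * ‖u‖ ≤ ‖∑ i ∈ S, inner ℝ (phi i) u • phi i‖ := by
  rw [← toEuclideanLin_gram]
  refine le_trans (mul_le_mul_of_nonneg_right ?_ (norm_nonneg u))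
    (singularValues_last_mul_norm_le _ (d := d) (by simp) u)
  exact csInf_le ((selectionMatrices_finite n _).image _).bddBelow ⟨_, selector_mem S, rfl⟩

theorem le_psiPlus (S : Finset (Fin n)) (u : EuclideanSpace ℝ (Fin d)) :
    ‖∑ i ∈ S, inner ℝ (phi i) u • phi i‖ ≤ psiPlus phi S.card * ‖u‖ := by
  rw [← toEuclideanLin_gram]
  refine le_trans (norm_le_singularValues_zero _ u)
    (mul_le_mul_of_nonneg_right ?_ (norm_nonneg u))
  exact le_csSup ((selectionMatrices_finite n _).image _).bddAbove ⟨_, selector_mem S, rfl⟩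

theorem inner_gram (S : Finset (Fin n)) (u : EuclideanSpace ℝ (Fin d)) :
    inner ℝ u (∑ i ∈ S, inner ℝ (phi i) u • phi i) = ∑ i ∈ S, (inner ℝ (phi i) u) ^ 2 := by
  rw [inner_sum]
  refine Finset.sum_congr rfl fun i _ => ?_
  rw [real_inner_smul_right, real_inner_comm, sq]

theorem IsRegular.sum_sq_le {c₀ A B : ℝ} (h : IsRegular c₀ A B phi) (hc : c₀ ≤ 1)
    (u : EuclideanSpace ℝ (Fin d)) : ∑ i, (inner ℝ (phi i) u) ^ 2 ≤ B * n * ‖u‖ ^ 2 := by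
  have h1 := ((h 1 hc le_rfl).2).2
  rw [one_mul, Nat.floor_natCast] at h1
  have h2 := le_psiPlus (phi := phi) Finset.univ u
  rw [Finset.card_univ, Fintype.card_fin] at h2
  rw [← inner_gram]
  calc _ ≤ ‖u‖ * ‖∑ i, inner ℝ (phi i) u • phi i‖ := real_inner_le_norm _ _
    _ ≤ ‖u‖ * (B * n * ‖u‖) := by gcongr; exact h2.trans (by gcongr)
    _ = _ := by ring

/-- The operator norm bound for the transposed feature matrix. -/
theorem norm_sum_smul_sq_le {D : ℝ} (hD0 : 0 ≤ D) (hD : ∀ u, ∑ i, (inner ℝ (phi i) u) ^ 2 ≤ D * ‖u‖ ^ 2)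
    (S : Finset (Fin n)) (s : Fin n → ℝ) :
    ‖∑ i ∈ S, s i • phi i‖ ^ 2 ≤ D * ∑ i ∈ S, s i ^ 2 := by
  set z := ∑ i ∈ S, s i • phi i with hz
  have h1 : ‖z‖ ^ 2 = ∑ i ∈ S, s i * inner ℝ (phi i) z := by
    rw [← real_inner_self_eq_norm_sq]
    nth_rw 1 [hz]
    rw [sum_inner]
    simp [real_inner_smul_left]
  have h2 := Finset.sum_mul_sq_le_sq_mul_sq S s fun i => inner ℝ (phi i) z
  rw [← h1] at h2
  have h3 : ∑ i ∈ S, (inner ℝ (phi i) z) ^ 2 ≤ D * ‖z‖ ^ 2 :=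
    (Finset.sum_le_univ_sum_of_nonneg fun i => sq_nonneg _).trans (hD z)
  have h4 : 0 ≤ ∑ i ∈ S, s i ^ 2 := Finset.sum_nonneg fun i _ => sq_nonneg _
  rcases (sq_nonneg ‖z‖).eq_or_lt with h0 | h0
  · rw [← h0]
    positivity
  · have h5 : ‖z‖ ^ 2 * ‖z‖ ^ 2 ≤ (D * ∑ i ∈ S, s i ^ 2) * ‖z‖ ^ 2 := by nlinarith
    exact le_of_mul_le_mul_right h5 h0

/-- The Gram vector of S has norm at least An‖u‖, while its squared norm is at most Bn times the
quadratic form. Dividing yields the constant A²/B, with no need to identify singular values with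
eigenvalues. -/
theorem IsRegular.le_sum_sq {c₀ A B β : ℝ} (h : IsRegular c₀ A B phi) (hA : 0 < A) (hB : 0 < B)
    (hβ : c₀ ≤ β) (hβ1 : β ≤ 1) (hn : 0 < n) (S : Finset (Fin n)) (hS : S.card = ⌊β * n⌋₊)
    (u : EuclideanSpace ℝ (Fin d)) :
    A ^ 2 / B * n * ‖u‖ ^ 2 ≤ ∑ i ∈ S, (inner ℝ (phi i) u) ^ 2 := by
  have h1 := ((h β hβ hβ1).1).1
  have h2 := psiMinus_le (phi := phi) S u
  rw [hS] at h2
  have hn' : (0 : ℝ) < n := by exact_mod_cast hn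
  have h3 : (A * n * ‖u‖) ^ 2 ≤ B * n * ∑ i ∈ S, (inner ℝ (phi i) u) ^ 2 :=
    le_trans (pow_le_pow_left₀ (by positivity)
      ((mul_le_mul_of_nonneg_right h1 (norm_nonneg u)).trans h2) 2)
      (norm_sum_smul_sq_le (by positivity) (h.sum_sq_le (hβ.trans hβ1)) S _)
  have h4 : A ^ 2 / B * n * ‖u‖ ^ 2 = (A * n * ‖u‖) ^ 2 / (B * n) := by field_simp
  rw [h4, div_le_iff₀ (by positivity)]
  linarith

/-- The empty selection has Gram matrix 0, so ψ⁻(0) ≤ 0 < An contradicts regularity. This makes ⌊αn⌋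
at least 1, hence at least αn/2. -/
theorem IsRegular.floor_pos {c₀ A B β : ℝ} (h : IsRegular c₀ A B phi) (hA : 0 < A)
    (hβ : c₀ ≤ β) (hβ1 : β ≤ 1) (hn : 0 < n) : 0 < ⌊β * n⌋₊ := by
  rw [Nat.pos_iff_ne_zero]
  intro h0
  have h1 := ((h β hβ hβ1).1).1
  rw [h0] at h1
  have hn' : (0 : ℝ) < n := by exact_mod_cast hn
  have h2 : psiMinus phi 0 ≤ 0 := by
    refine csInf_le ((selectionMatrices_finite n _).image _).bddBelow
      ⟨_, selector_mem (n := n) ∅, ?_⟩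
    have : selector (n := n) ∅ = 0 := by ext i j; simp [selector]
    simp [sigmaMin, this]
  nlinarith [mul_pos hA hn']

/-- The lower bound survives the removal of a small fraction of the samples: those that are
removed can be replaced by samples on which the quadratic form is at most its average. -/
theorem le_sum_sq_of_card_ge {B D γ ε : ℝ} {k : ℕ} (hB : 0 ≤ B) (hγ : 0 < γ)
    (hD : ∀ u, ∑ i, (inner ℝ (phi i) u) ^ 2 ≤ B * n * ‖u‖ ^ 2)
    (hk : ∀ S : Finset (Fin n), S.card = k → ∀ u,
      D * n * ‖u‖ ^ 2 ≤ ∑ i ∈ S, (inner ℝ (phi i) u) ^ 2)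
    (hkn : (k : ℝ) ≤ (1 - γ) * n) (hεD : 4 * ε * B ≤ γ * D)
    {S : Finset (Fin n)} (hS : (k : ℝ) ≤ S.card + ε * n) (hSk : S.card ≤ k)
    (u : EuclideanSpace ℝ (Fin d)) :
    D / 2 * n * ‖u‖ ^ 2 ≤ ∑ i ∈ S, (inner ℝ (phi i) u) ^ 2 := by
  classical
  set x : Fin n → ℝ := fun i => (inner ℝ (phi i) u) ^ 2 with hx
  have hx0 : ∀ i, 0 ≤ x i := fun i => sq_nonneg _
  -- By Markov's inequality at most γn/2 samples exceed this level, so outside S enough samples lie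
  -- below it to refill S to k elements.
  set t : ℝ := 2 * B / γ * ‖u‖ ^ 2 with ht
  have ht0 : 0 ≤ t := by positivity
  set P : Finset (Fin n) := Sᶜ.filter fun i => x i ≤ t with hP
  set Q : Finset (Fin n) := Sᶜ.filter fun i => ¬ x i ≤ t with hQ
  have hcard : P.card + Q.card + S.card = n := by
    rw [hP, hQ, Finset.card_filter_add_card_filter_not, Finset.card_compl, Fintype.card_fin]
    have := S.card_le_univ
    simp at this
    omega
  have hQt : (Q.card : ℝ) * t ≤ B * n * ‖u‖ ^ 2 := by
    calc (Q.card : ℝ) * t = ∑ i ∈ Q, t := by simp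
      _ ≤ ∑ i ∈ Q, x i := Finset.sum_le_sum fun i hi => by
          rw [hQ, Finset.mem_filter] at hi; exact (not_le.mp hi.2).le
      _ ≤ ∑ i, x i := Finset.sum_le_univ_sum_of_nonneg hx0
      _ ≤ _ := hD u
  -- The Markov bound divides by B‖u‖². If this vanishes, the whole quadratic form is zero and any
  -- superset of S with k elements settles the claim.
  by_cases hu : B * ‖u‖ ^ 2 = 0
  · have h1 : ∑ i, x i ≤ 0 := (hD u).trans (by rw [mul_right_comm, hu, zero_mul])
    obtain ⟨T, hT⟩ : ∃ T : Finset (Fin n), S ⊆ T ∧ T.card = k :=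
      Finset.exists_superset_card_eq hSk (by
        rw [Fintype.card_fin]
        have : (k : ℝ) ≤ n := hkn.trans (by nlinarith [(Nat.cast_nonneg n : (0 : ℝ) ≤ n)])
        exact_mod_cast this)
    have h2 := hk T hT.2 u
    have h3 : ∑ i ∈ T, x i ≤ ∑ i, x i := Finset.sum_le_univ_sum_of_nonneg hx0
    have h4 : 0 ≤ ∑ i ∈ S, x i := Finset.sum_nonneg fun i _ => hx0 i
    change D * n * ‖u‖ ^ 2 ≤ ∑ i ∈ T, x i at h2
    nlinarith
  have hBu : 0 < B * ‖u‖ ^ 2 := lt_of_le_of_ne (by positivity) (Ne.symm hu)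
  have hQc : (Q.card : ℝ) ≤ γ / 2 * n := by
    have h1 : (Q.card : ℝ) * (2 / γ) * (B * ‖u‖ ^ 2) ≤ n * (B * ‖u‖ ^ 2) := by
      calc _ = (Q.card : ℝ) * t := by rw [ht]; ring
        _ ≤ _ := by linarith
    have h2 := le_of_mul_le_mul_right h1 hBu
    rw [mul_div_assoc', div_le_iff₀ hγ] at h2
    linarith
  have hPc : k - S.card ≤ P.card := by
    have h1 : (P.card : ℝ) + Q.card + S.card = n := by exact_mod_cast hcard
    have hn0 : (0 : ℝ) ≤ n := Nat.cast_nonneg n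
    have h3 : (k : ℝ) ≤ P.card + S.card := by
      have h4 : (S.card : ℝ) ≤ k := by exact_mod_cast hSk
      nlinarith
    have : k ≤ P.card + S.card := by exact_mod_cast h3
    omega
  obtain ⟨T, hTP, hTc⟩ := Finset.exists_subset_card_eq hPc
  have hdis : Disjoint S T := by
    rw [Finset.disjoint_left]
    intro i hi hiT
    have := hTP hiT
    rw [hP, Finset.mem_filter, Finset.mem_compl] at this
    exact this.1 hi
  have h1 := hk (S ∪ T) (by rw [Finset.card_union_of_disjoint hdis, hTc]; omega) u
  rw [Finset.sum_union hdis] at h1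
  have h2 : ∑ i ∈ T, x i ≤ T.card * t := by
    rw [← nsmul_eq_mul]
    refine Finset.sum_le_card_nsmul _ _ _ fun i hi => ?_
    have := hTP hi
    rw [hP, Finset.mem_filter] at this
    exact this.2
  have h3 : (T.card : ℝ) ≤ ε * n := by
    rw [hTc, Nat.cast_sub hSk]
    linarith
  have h4 : (T.card : ℝ) * t ≤ D / 2 * n * ‖u‖ ^ 2 := by
    calc (T.card : ℝ) * t ≤ ε * n * t := by gcongr
      _ = (4 * ε * B) / γ * (n * ‖u‖ ^ 2 / 2) := by rw [ht]; ring
      _ ≤ (γ * D) / γ * (n * ‖u‖ ^ 2 / 2) := by gcongr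
      _ = _ := by field_simp
  change D * n * ‖u‖ ^ 2 ≤ ∑ i ∈ S, x i + ∑ i ∈ T, x i at h1
  linarith

end ITLM

/-! ### Deterministic analysis of one gradient step. -/

namespace ITLM

variable {n d : ℕ} {phi : Fin n → EuclideanSpace ℝ (Fin d)} {link : ℝ → ℝ} {a b : ℝ}

/-- Exchange argument: swapping i for j keeps the cardinality, so it cannot lower the total loss. -/
theorem IsTrimmedSet.sqLoss_le {y : Fin n → ℝ} {α : ℝ} {θ : EuclideanSpace ℝ (Fin d)}
    {S : Finset (Fin n)} (h : IsTrimmedSet link phi y α θ S) {i j : Fin n} (hi : i ∈ S)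
    (hj : j ∉ S) : sqLoss link (phi i) (y i) θ ≤ sqLoss link (phi j) (y j) θ := by
  have hj' : j ∉ S.erase i := fun h => hj (Finset.mem_of_mem_erase h)
  have h1 := h.2 (insert j (S.erase i)) (by
    rw [Finset.card_insert_of_notMem hj', Finset.card_erase_add_one hi, h.1])
  rw [Finset.sum_insert hj', ← Finset.add_sum_erase S _ hi] at h1
  linarith

theorem gradient_sqLoss (hl : Differentiable ℝ link) (v : EuclideanSpace ℝ (Fin d)) (y : ℝ)
    (θ : EuclideanSpace ℝ (Fin d)) : gradient (sqLoss link v y) θ =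
      (-2 * ((y - link (inner ℝ v θ)) * deriv link (inner ℝ v θ))) • v := by
  apply HasGradientAt.gradient
  rw [hasGradientAt_iff_hasFDerivAt]
  have h1 : HasFDerivAt (fun θ : EuclideanSpace ℝ (Fin d) => inner ℝ v θ) (innerSL ℝ v) θ :=
    (innerSL ℝ v).hasFDerivAt
  have h2 := (hl (inner ℝ v θ)).hasDerivAt.comp_hasFDerivAt θ h1
  have h3 := (h2.const_sub y).pow 2
  refine h3.congr_fderiv ?_
  ext w
  simp [InnerProductSpace.toDual_apply_apply]
  ring

theorem IsLink.exists_slope (hl : IsLink a b link) (u v : ℝ) :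
    ∃ m ∈ Set.Icc a b, link u - link v = m * (u - v) := by
  rcases lt_trichotomy u v with h | h | h
  · obtain ⟨c, -, hc⟩ := exists_deriv_eq_slope link h hl.2.1.continuous.continuousOn
      hl.2.1.differentiableOn
    refine ⟨_, hl.2.2 c, ?_⟩
    rw [hc]
    have : v - u ≠ 0 := by linarith
    field_simp
    ring
  · exact ⟨_, hl.2.2 0, by simp [h]⟩
  · obtain ⟨c, -, hc⟩ := exists_deriv_eq_slope link h hl.2.1.continuous.continuousOn
      hl.2.1.differentiableOn
    refine ⟨_, hl.2.2 c, ?_⟩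
    rw [hc]
    have : u - v ≠ 0 := by linarith
    field_simp

theorem IsLink.abs_sub_le (hl : IsLink a b link) (ha : 0 < a) (u v : ℝ) :
    |link u - link v| ≤ b * |u - v| := by
  obtain ⟨m, hm, h⟩ := hl.exists_slope u v
  rw [h, abs_mul, abs_of_pos (ha.trans_le hm.1)]
  exact mul_le_mul_of_nonneg_right hm.2 (abs_nonneg _)

/-- A preconditioned gradient step for a weighted quadratic form is a contraction. -/
theorem norm_sub_smul_gram_le {B D s : ℝ} (ha : 0 < a) (hB : 0 ≤ B) (hD : 0 ≤ D)
    (hs : 0 ≤ s) {G : Finset (Fin n)} {w : Fin n → ℝ}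
    (hw : ∀ i ∈ G, w i ∈ Set.Icc (a ^ 2) (b ^ 2)) {Δ : EuclideanSpace ℝ (Fin d)}
    (hU : ∀ u, ∑ i, (inner ℝ (phi i) u) ^ 2 ≤ B * n * ‖u‖ ^ 2)
    (hG : D * n * ‖Δ‖ ^ 2 ≤ ∑ i ∈ G, (inner ℝ (phi i) Δ) ^ 2)
    (hs1 : s * n * (b ^ 4 * B ^ 2) ≤ a ^ 2 * D) (hs2 : s * n * (a ^ 2 * D) ≤ 1) :
    ‖Δ - s • ∑ i ∈ G, (w i * inner ℝ (phi i) Δ) • phi i‖ ≤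
      (1 - s * n * (a ^ 2 * D) / 2) * ‖Δ‖ := by
  set H := ∑ i ∈ G, (w i * inner ℝ (phi i) Δ) • phi i with hH
  have h1 : a ^ 2 * (D * n * ‖Δ‖ ^ 2) ≤ inner ℝ Δ H := by
    rw [hH, inner_sum]
    refine (mul_le_mul_of_nonneg_left hG (sq_nonneg a)).trans ?_
    rw [Finset.mul_sum]
    refine Finset.sum_le_sum fun i hi => ?_
    rw [real_inner_smul_right, real_inner_comm Δ, mul_assoc, ← sq]
    exact mul_le_mul_of_nonneg_right (hw i hi).1 (sq_nonneg _)
  have h2 : ‖H‖ ^ 2 ≤ b ^ 4 * (B * n) ^ 2 * ‖Δ‖ ^ 2 := by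
    refine (norm_sum_smul_sq_le (by positivity) hU G _).trans ?_
    have h3 : ∑ i ∈ G, (w i * inner ℝ (phi i) Δ) ^ 2 ≤ b ^ 4 * (B * n * ‖Δ‖ ^ 2) := by
      calc _ ≤ ∑ i ∈ G, b ^ 4 * (inner ℝ (phi i) Δ) ^ 2 := Finset.sum_le_sum fun i hi => by
            rw [mul_pow]
            refine mul_le_mul_of_nonneg_right ?_ (sq_nonneg _)
            calc w i ^ 2 ≤ (b ^ 2) ^ 2 :=
                  pow_le_pow_left₀ ((sq_nonneg a).trans (hw i hi).1) (hw i hi).2 2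
              _ = b ^ 4 := by ring
        _ ≤ b ^ 4 * ∑ i, (inner ℝ (phi i) Δ) ^ 2 := by
            rw [← Finset.mul_sum]
            exact mul_le_mul_of_nonneg_left
              (Finset.sum_le_univ_sum_of_nonneg fun i => sq_nonneg _) (by positivity)
        _ ≤ _ := mul_le_mul_of_nonneg_left (hU Δ) (by positivity)
    calc _ ≤ B * n * (b ^ 4 * (B * n * ‖Δ‖ ^ 2)) :=
          mul_le_mul_of_nonneg_left h3 (by positivity)
      _ = _ := by ring
  have hp : 0 ≤ s * n * (a ^ 2 * D) := by positivity
  refine abs_le_of_sq_le_sq' ?_ (mul_nonneg (by linarith) (norm_nonneg _)) |>.2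
  rw [norm_sub_sq_real, real_inner_smul_right, norm_smul, mul_pow, Real.norm_of_nonneg hs]
  have h4 : s ^ 2 * ‖H‖ ^ 2 ≤ s * n * (a ^ 2 * D) * ‖Δ‖ ^ 2 := by
    calc s ^ 2 * ‖H‖ ^ 2 ≤ s ^ 2 * (b ^ 4 * (B * n) ^ 2 * ‖Δ‖ ^ 2) := by gcongr
      _ = s * n * (s * n * (b ^ 4 * B ^ 2)) * ‖Δ‖ ^ 2 := by ring
      _ ≤ _ := by gcongr
  have h5 : s * (a ^ 2 * (D * n * ‖Δ‖ ^ 2)) ≤ s * inner ℝ Δ H :=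
    mul_le_mul_of_nonneg_left h1 hs
  -- With p = sna²D, the cross term gains 2p and the quadratic term costs at most p, so the squared
  -- norm is at most (1 - p)‖Δ‖² ≤ (1 - p/2)²‖Δ‖².
  nlinarith [mul_nonneg (sq_nonneg (s * n * (a ^ 2 * D))) (sq_nonneg ‖Δ‖)]

variable {θ θstar : EuclideanSpace ℝ (Fin d)} {Sstar S : Finset (Fin n)} {r e : Fin n → ℝ}

/-- A bound for the residuals of the selected samples. -/
noncomputable def residualRadius (B γ b σ : ℝ) (Δ : ℝ) : ℝ := √((2 * B + 18) / γ) * (b * Δ + σ)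

/-- At least γn clean samples are left unselected, each with squared residual at least that of i.
Their squared residuals sum to at most 2b²Bn‖Δ‖² + 18nσ², so the average bounds the residual of i,
whatever its output. -/
theorem abs_residual_le {B γ σ α : ℝ} (hl : IsLink a b link) (ha : 0 < a) (hab : a ≤ b)
    (hB : 0 ≤ B) (hγ : 0 < γ) (hσ : 0 ≤ σ) (hn : 0 < n)
    (hU : ∀ u, ∑ i, (inner ℝ (phi i) u) ^ 2 ≤ B * n * ‖u‖ ^ 2)
    (he : ∑ i, e i ^ 2 ≤ 9 * n * σ ^ 2)
    (hS : IsTrimmedSet link phi (output link phi Sstar θstar r e) α θ S)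
    (hSc : S.card + γ * n ≤ Sstar.card) {i : Fin n} (hi : i ∈ S) :
    |output link phi Sstar θstar r e i - link (inner ℝ (phi i) θ)| ≤
      residualRadius B γ b σ ‖θ - θstar‖ := by
  set ρ := fun i => output link phi Sstar θstar r e i - link (inner ℝ (phi i) θ) with hρ
  have hn' : (0 : ℝ) < n := by exact_mod_cast hn
  have h1 : ∀ j ∈ Sstar \ S, ρ i ^ 2 ≤
      2 * b ^ 2 * (inner ℝ (phi j) (θ - θstar)) ^ 2 + 2 * e j ^ 2 := by
    intro j hj
    rw [Finset.mem_sdiff] at hj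
    refine (hS.sqLoss_le hi hj.2).trans ?_
    have h2 := hl.abs_sub_le ha (inner ℝ (phi j) θstar) (inner ℝ (phi j) θ)
    rw [← inner_sub_right, ← neg_sub θ θstar, inner_neg_right, abs_neg] at h2
    have h3 := pow_le_pow_left₀ (abs_nonneg _) h2 2
    rw [sq_abs, mul_pow, sq_abs] at h3
    simp only [sqLoss, output, hj.1, if_true]
    nlinarith [sq_nonneg (link (inner ℝ (phi j) θstar) - link (inner ℝ (phi j) θ) - e j)]
  have h2 : γ * n * ρ i ^ 2 ≤ 2 * b ^ 2 * (B * n * ‖θ - θstar‖ ^ 2) + 2 * (9 * n * σ ^ 2) := by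
    have hc : γ * n ≤ (Sstar \ S).card := by
      have := Finset.le_card_sdiff S Sstar
      have : (Sstar.card : ℝ) ≤ (Sstar \ S).card + S.card := by
        exact_mod_cast (by omega : Sstar.card ≤ (Sstar \ S).card + S.card)
      linarith
    calc γ * n * ρ i ^ 2 ≤ (Sstar \ S).card * ρ i ^ 2 := by gcongr
      _ = ∑ j ∈ Sstar \ S, ρ i ^ 2 := by simp
      _ ≤ ∑ j ∈ Sstar \ S, (2 * b ^ 2 * (inner ℝ (phi j) (θ - θstar)) ^ 2 + 2 * e j ^ 2) :=
          Finset.sum_le_sum h1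
      _ ≤ ∑ j, (2 * b ^ 2 * (inner ℝ (phi j) (θ - θstar)) ^ 2 + 2 * e j ^ 2) :=
          Finset.sum_le_univ_sum_of_nonneg fun j => by positivity
      _ = 2 * b ^ 2 * ∑ j, (inner ℝ (phi j) (θ - θstar)) ^ 2 + 2 * ∑ j, e j ^ 2 := by
          rw [Finset.sum_add_distrib, Finset.mul_sum, Finset.mul_sum]
      _ ≤ _ := by gcongr; exact hU _
  have hb : 0 ≤ b := ha.le.trans hab
  have hT : 0 ≤ residualRadius B γ b σ ‖θ - θstar‖ := by unfold residualRadius; positivity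
  refine abs_le_of_sq_le_sq ?_ hT
  rw [residualRadius, mul_pow, Real.sq_sqrt (by positivity), div_mul_eq_mul_div, le_div_iff₀ hγ]
  have h3 : n * (ρ i ^ 2 * γ) ≤ n * (2 * b ^ 2 * (B * ‖θ - θstar‖ ^ 2) + 2 * (9 * σ ^ 2)) := by
    linarith
  refine (le_of_mul_le_mul_left h3 hn').trans ?_
  have h4 : 0 ≤ b * ‖θ - θstar‖ * σ := by positivity
  nlinarith [mul_nonneg hB h4, mul_nonneg hB (sq_nonneg σ), sq_nonneg (b * ‖θ - θstar‖)]

theorem modelUpdate_eq (hl : Differentiable ℝ link) (y : Fin n → ℝ) (η : ℝ)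
    (θ : EuclideanSpace ℝ (Fin d)) : modelUpdate link phi y η S θ =
      θ + (2 * η / S.card) • ∑ i ∈ S, ((y i - link (inner ℝ (phi i) θ)) *
        deriv link (inner ℝ (phi i) θ)) • phi i := by
  rw [modelUpdate, sub_eq_add_neg]
  congr 1
  simp only [gradient_sqLoss hl, smul_smul, Finset.smul_sum, ← Finset.sum_neg_distrib, ← neg_smul]
  refine Finset.sum_congr rfl fun i _ => ?_
  congr 1
  ring

/-- One step, given a bound for the contribution of the bad samples. -/
theorem norm_modelUpdate_sub_le {B D α η σ Z : ℝ} (hl : IsLink a b link) (ha : 0 < a)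
    (hab : a ≤ b) (hB : 0 ≤ B) (hD : 0 ≤ D) (hη : 0 ≤ η) (hσ : 0 ≤ σ) (hn : 0 < n)
    (hα : 0 < α) (hU : ∀ u, ∑ i, (inner ℝ (phi i) u) ^ 2 ≤ B * n * ‖u‖ ^ 2)
    (hG : ∀ u, D * n * ‖u‖ ^ 2 ≤ ∑ i ∈ S ∩ Sstar, (inner ℝ (phi i) u) ^ 2)
    (he : ∑ i, e i ^ 2 ≤ 9 * n * σ ^ 2)
    (hη1 : 4 * η / α * (b ^ 4 * B ^ 2) ≤ a ^ 2 * D) (hη2 : 4 * η / α * (a ^ 2 * D) ≤ 1)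
    (hSα : α / 2 * n ≤ S.card)
    (hZ : ‖∑ i ∈ S \ Sstar, ((output link phi Sstar θstar r e i - link (inner ℝ (phi i) θ)) *
        deriv link (inner ℝ (phi i) θ)) • phi i‖ ≤ n * (b * Z)) :
    ‖θstar - modelUpdate link phi (output link phi Sstar θstar r e) η S θ‖ ≤
      (1 - η * (a ^ 2 * D)) * ‖θ - θstar‖ + 4 * η / α * (b * (√(9 * B) * σ)) +
        4 * η / α * (b * Z) := by
  have hn' : (0 : ℝ) < n := by exact_mod_cast hn
  have hb : 0 < b := ha.trans_le hab
  have hSpos : (0 : ℝ) < S.card := lt_of_lt_of_le (by positivity) hSα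
  have hSn : (S.card : ℝ) ≤ n := by
    have := S.card_le_univ
    rw [Fintype.card_fin] at this
    exact_mod_cast this
  set s := 2 * η / S.card with hs
  have hs0 : 0 ≤ s := by positivity
  -- Since αn/2 ≤ |S| ≤ n, the effective step sn lies between 2η and 4η/α: the lower end drives the
  -- contraction, the upper end bounds the errors.
  have hsn1 : s * n ≤ 4 * η / α := by
    rw [hs, div_mul_eq_mul_div, div_le_div_iff₀ hSpos hα]
    nlinarith
  have hsn2 : 2 * η ≤ s * n := by
    rw [hs, div_mul_eq_mul_div, le_div_iff₀ hSpos]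
    nlinarith
  have hder : ∀ i, deriv link (inner ℝ (phi i) θ) ∈ Set.Icc a b := fun i => hl.2.2 _
  choose m hm hmeq using fun i => hl.exists_slope (inner ℝ (phi i) θ) (inner ℝ (phi i) θstar)
  set X := ∑ i ∈ S ∩ Sstar, (m i * deriv link (inner ℝ (phi i) θ) *
    inner ℝ (phi i) (θ - θstar)) • phi i with hX
  set Y := ∑ i ∈ S ∩ Sstar, (e i * deriv link (inner ℝ (phi i) θ)) • phi i with hY
  set W := ∑ i ∈ S \ Sstar, ((output link phi Sstar θstar r e i - link (inner ℝ (phi i) θ)) *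
        deriv link (inner ℝ (phi i) θ)) • phi i with hW
  have hdecomp : modelUpdate link phi (output link phi Sstar θstar r e) η S θ - θstar =
      ((θ - θstar) - s • X) + s • Y + s • W := by
    rw [modelUpdate_eq hl.2.1, ← Finset.sum_inter_add_sum_sdiff S Sstar]
    have : ∑ i ∈ S ∩ Sstar, ((output link phi Sstar θstar r e i - link (inner ℝ (phi i) θ)) *
        deriv link (inner ℝ (phi i) θ)) • phi i = Y - X := by
      rw [hX, hY, ← Finset.sum_sub_distrib]
      refine Finset.sum_congr rfl fun i hi => ?_
      rw [← sub_smul]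
      congr 1
      simp only [output, (Finset.mem_inter.mp hi).2, if_true, inner_sub_right]
      linear_combination (-deriv link (inner ℝ (phi i) θ)) * hmeq i
    rw [this, smul_add, smul_sub]
    abel
  have h1 : ‖(θ - θstar) - s • X‖ ≤ (1 - s * n * (a ^ 2 * D) / 2) * ‖θ - θstar‖ := by
    refine norm_sub_smul_gram_le (b := b) ha hB hD hs0 (fun i _ => ⟨?_, ?_⟩) hU (hG _) ?_ ?_
    · rw [sq]; exact mul_le_mul (hm i).1 (hder i).1 ha.le (ha.le.trans (hm i).1)
    · rw [sq]; exact mul_le_mul (hm i).2 (hder i).2 (ha.le.trans (hder i).1) hb.le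
    · exact (mul_le_mul_of_nonneg_right hsn1 (by positivity)).trans hη1
    · exact (mul_le_mul_of_nonneg_right hsn1 (by positivity)).trans hη2
  have h2 : ‖Y‖ ≤ n * (b * (√(9 * B) * σ)) := by
    refine abs_le_of_sq_le_sq' ?_ (by positivity) |>.2
    refine (norm_sum_smul_sq_le (by positivity) hU _ _).trans ?_
    calc B * n * ∑ i ∈ S ∩ Sstar, (e i * deriv link (inner ℝ (phi i) θ)) ^ 2
        ≤ B * n * ∑ i ∈ S ∩ Sstar, b ^ 2 * e i ^ 2 := by
          gcongr with i
          rw [mul_pow, mul_comm]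
          gcongr
          · exact ha.le.trans (hder i).1
          · exact (hder i).2
      _ ≤ B * n * (b ^ 2 * ∑ i, e i ^ 2) := by
          rw [← Finset.mul_sum]
          gcongr
          exact Finset.subset_univ _
      _ ≤ B * n * (b ^ 2 * (9 * n * σ ^ 2)) := by gcongr
      _ = (n * (b * (√(9 * B) * σ))) ^ 2 := by
          rw [mul_pow, mul_pow, mul_pow, Real.sq_sqrt (by positivity)]; ring
  rw [norm_sub_rev, hdecomp]
  have hbZ : 0 ≤ b * Z := by
    have := (norm_nonneg _).trans hZ
    exact nonneg_of_mul_nonneg_right this hn'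
  calc _ ≤ ‖(θ - θstar) - s • X‖ + ‖s • Y‖ + ‖s • W‖ := norm_add₃_le
    _ ≤ (1 - η * (a ^ 2 * D)) * ‖θ - θstar‖ + s * (n * (b * (√(9 * B) * σ))) +
        s * (n * (b * Z)) := by
      rw [norm_smul, norm_smul, Real.norm_of_nonneg hs0]
      gcongr
      refine h1.trans ?_
      gcongr
      have : 2 * η * (a ^ 2 * D) ≤ s * n * (a ^ 2 * D) := by gcongr
      linarith
    _ ≤ _ := by
      rw [← mul_assoc s, ← mul_assoc s]
      gcongr

/-- Cauchy–Schwarz bound for the contribution of the bad samples. -/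
theorem norm_bad_sum_le {B T ε : ℝ} (hl : IsLink a b link) (ha : 0 < a) (hab : a ≤ b)
    (hB : 0 ≤ B) (hT : 0 ≤ T) (hε : 0 ≤ ε) {P : Finset (Fin n)} (hP : (P.card : ℝ) ≤ ε * n)
    (hU : ∀ u, ∑ i, (inner ℝ (phi i) u) ^ 2 ≤ B * n * ‖u‖ ^ 2) {ρ : Fin n → ℝ}
    (hρ : ∀ i ∈ P, |ρ i| ≤ T) :
    ‖∑ i ∈ P, (ρ i * deriv link (inner ℝ (phi i) θ)) • phi i‖ ≤
      n * (b * (T * √(ε * B))) := by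
  have hb : 0 < b := ha.trans_le hab
  refine abs_le_of_sq_le_sq' ?_ (by positivity) |>.2
  refine (norm_sum_smul_sq_le (by positivity) hU _ _).trans ?_
  calc B * n * ∑ i ∈ P, (ρ i * deriv link (inner ℝ (phi i) θ)) ^ 2
      ≤ B * n * ∑ i ∈ P, (T * b) ^ 2 := by
        refine mul_le_mul_of_nonneg_left (Finset.sum_le_sum fun i hi => ?_) (by positivity)
        rw [← sq_abs, abs_mul]
        have h1 := (hl.2.2 (inner ℝ (phi i) θ))
        have h2 := hρ i hi
        have h3 := ha.le.trans h1.1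
        rw [abs_of_nonneg h3]
        have h4 := h1.2
        gcongr
    _ = B * n * (P.card * (T * b) ^ 2) := by simp
    _ ≤ B * n * (ε * n * (T * b) ^ 2) := by gcongr
    _ = _ := by
        rw [mul_pow, mul_pow, mul_pow, mul_pow, Real.sq_sqrt (by positivity)]; ring

end ITLM

/-! ### Moments and the Euclidean norm of the noise. -/

namespace ITLM

variable {Ω : Type*} [MeasurableSpace Ω] {μ : Measure Ω}

theorem pow_le_factorial_mul_exp_add_exp (x : ℝ) {m : ℕ} (hm : Even m) :
    x ^ m ≤ m.factorial * (Real.exp x + Real.exp (-x)) := by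
  have h1 := Real.pow_div_factorial_le_exp |x| (abs_nonneg x) m
  rw [hm.pow_abs, div_le_iff₀' (by positivity)] at h1
  refine h1.trans (mul_le_mul_of_nonneg_left ?_ (by positivity))
  rcases abs_cases x with ⟨h, -⟩ | ⟨h, -⟩ <;> rw [h]
  · linarith [Real.exp_pos (-x)]
  · linarith [Real.exp_pos x]

/-- Even moments of a sub-Gaussian variable. -/
theorem integral_pow_le_of_hasSubgaussianMGF {X : Ω → ℝ} {σ : ℝ≥0}
    (hσ : 0 < σ) (h : HasSubgaussianMGF X (σ ^ 2) μ) {m : ℕ} (hm : Even m) :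
    ∫ w, X w ^ m ∂μ ≤ m.factorial * 4 * (σ : ℝ) ^ m := by
  have hσ' : (0 : ℝ) < σ := by exact_mod_cast hσ
  have h2 : Real.exp (1 / 2) ≤ 2 := by
    have h3 := Real.exp_one_lt_d9
    have h4 : Real.exp (1 / 2) ^ 2 = Real.exp 1 := by rw [← Real.exp_nat_mul]; norm_num
    nlinarith [Real.exp_pos (1 / 2)]
  have hmgf : ∀ t : ℝ, |t| = (σ : ℝ)⁻¹ → ∫ w, Real.exp (t * X w) ∂μ ≤ 2 := by
    intro t ht
    refine (h.mgf_le t).trans (le_trans (le_of_eq ?_) h2)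
    rw [← sq_abs t, ht]
    congr 1
    push_cast
    field_simp
  have h3 : ∀ w, X w ^ m ≤ (m.factorial * (σ : ℝ) ^ m) *
      (Real.exp ((σ : ℝ)⁻¹ * X w) + Real.exp (-(σ : ℝ)⁻¹ * X w)) := by
    intro w
    have := pow_le_factorial_mul_exp_add_exp ((σ : ℝ)⁻¹ * X w) hm
    rw [mul_pow, inv_pow, inv_mul_le_iff₀ (by positivity), ← neg_mul] at this
    linarith
  have hi := h.integrable_exp_mul
  calc ∫ w, X w ^ m ∂μ ≤ ∫ w, (m.factorial * (σ : ℝ) ^ m) *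
      (Real.exp ((σ : ℝ)⁻¹ * X w) + Real.exp (-(σ : ℝ)⁻¹ * X w)) ∂μ :=
        integral_mono_of_nonneg (.of_forall fun w => hm.pow_nonneg _)
          (((hi _).add (hi _)).const_mul _) (.of_forall h3)
    _ = (m.factorial * (σ : ℝ) ^ m) * (∫ w, Real.exp ((σ : ℝ)⁻¹ * X w) ∂μ +
          ∫ w, Real.exp (-(σ : ℝ)⁻¹ * X w) ∂μ) := by
        rw [integral_const_mul, integral_add (hi _) (hi _)]
    _ ≤ (m.factorial * (σ : ℝ) ^ m) * (2 + 2) := by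
        gcongr
        · exact hmgf _ (abs_of_pos (by positivity))
        · exact hmgf _ (by rw [abs_neg, abs_of_pos (by positivity)])
    _ = _ := by ring

/-- The Euclidean norm of the noise vector is of order `σ √n`. -/
theorem IsNoise.measure_sum_sq_gt_le [IsProbabilityMeasure μ] {n : ℕ} (hn : 0 < n) {σ : ℝ≥0}
    {e : Fin n → Ω → ℝ} (h : IsNoise σ e μ) :
    μ {w | ¬ ∑ i, e i w ^ 2 ≤ 9 * n * (σ : ℝ) ^ 2} ≤ ENNReal.ofReal (96 / n) := by
  obtain ⟨hmeas, hind, hsub⟩ := h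
  -- Chebyshev's inequality is used with deviation nσ², which must be positive; for σ = 0 the noise
  -- vanishes almost surely.
  rcases eq_or_ne σ 0 with rfl | hσ0
  · have h1 : ∀ᵐ w ∂μ, ∀ i, e i w = 0 := by
      rw [ae_all_iff]
      intro i
      have h2 := hsub i
      simp only [ne_eq, OfNat.ofNat_ne_zero, not_false_eq_true, zero_pow] at h2
      exact h2.ae_eq_zero_of_hasSubgaussianMGF_zero
    have h3 : ∀ᵐ w ∂μ, ∑ i, e i w ^ 2 ≤ 9 * n * (((0 : ℝ≥0) : ℝ)) ^ 2 := by
      filter_upwards [h1] with w hw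
      simp [hw]
    rw [ae_iff.mp h3]
    exact zero_le
  have hσ : 0 < σ := pos_iff_ne_zero.mpr hσ0
  have hσ' : (0 : ℝ) < σ := by exact_mod_cast hσ
  have hn' : (0 : ℝ) < n := by exact_mod_cast hn
  have hL : ∀ i, MemLp (fun w => e i w ^ 2) 2 μ := by
    intro i
    have h4 := (hsub i).memLp 4
    have h5 : MemLp (fun w => e i w ^ 2) 2 μ := by
      rw [memLp_two_iff_integrable_sq ((hmeas i).pow_const 2).aestronglyMeasurable]
      have := h4.integrable_norm_pow (by norm_num)
      refine this.congr (.of_forall fun w => ?_)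
      simp only [Real.norm_eq_abs, ← pow_mul]
      exact (by decide : Even 4).pow_abs _
    exact h5
  have hvar : Var[fun w => ∑ i, e i w ^ 2; μ] ≤ n * (96 * (σ : ℝ) ^ 4) := by
    have h1 := IndepFun.variance_sum (s := Finset.univ) (X := fun i w => e i w ^ 2)
      (fun i _ => hL i) (fun i _ j _ hij =>
        (hind.indepFun hij).comp (measurable_id.pow_const 2) (measurable_id.pow_const 2))
    have h2 : (∑ i, fun w => e i w ^ 2) = fun w => ∑ i, e i w ^ 2 := by ext w; simp
    rw [h2] at h1
    rw [h1]
    calc _ ≤ ∑ i : Fin n, 96 * (σ : ℝ) ^ 4 := by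
          refine Finset.sum_le_sum fun i _ => ?_
          refine (variance_le_expectation_sq (hL i).1).trans ?_
          have := integral_pow_le_of_hasSubgaussianMGF hσ (hsub i) (m := 4) (by decide)
          simp only [Pi.pow_apply, ← pow_mul]
          refine this.trans (le_of_eq ?_)
          norm_num [Nat.factorial]
      _ = _ := by simp
  have hmean : ∫ w, ∑ i, e i w ^ 2 ∂μ ≤ 8 * n * (σ : ℝ) ^ 2 := by
    rw [integral_finsetSum _ fun i _ => (hL i).integrable (by norm_num)]
    calc _ ≤ ∑ i : Fin n, 8 * (σ : ℝ) ^ 2 := by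
          refine Finset.sum_le_sum fun i _ => ?_
          refine (integral_pow_le_of_hasSubgaussianMGF hσ (hsub i) (m := 2) (by decide)).trans
            (le_of_eq ?_)
          norm_num [Nat.factorial]
      _ = _ := by simp; ring
  have hL2 : MemLp (fun w => ∑ i, e i w ^ 2) 2 μ := memLp_finsetSum _ fun i _ => hL i
  -- The mean is at most 8nσ², so exceeding 9nσ² is a deviation of nσ². The variance is at most
  -- 96nσ⁴, with 96 = 4! · 4 from the fourth moment.
  refine (measure_mono fun w hw => ?_).trans ((meas_ge_le_variance_div_sq hL2
    (c := n * (σ : ℝ) ^ 2) (by positivity)).trans (ENNReal.ofReal_le_ofReal ?_))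
  · simp only [Set.mem_ofPred_eq, not_le] at hw ⊢
    refine le_trans ?_ (le_abs_self _)
    linarith
  · rw [div_le_div_iff₀ (by positivity) hn']
    calc _ ≤ n * (96 * (σ : ℝ) ^ 4) * n := by gcongr
      _ = _ := by ring

end ITLM

/-! ### Interval probabilities and concentration of weighted indicators. -/

namespace ITLM

section Probability

variable {Ω : Type*} [MeasurableSpace Ω] {μ : Measure Ω}

/-- Adding independent noise to a variable with a bounded density does not increase the
probability of intervals beyond the density bound. -/
theorem measure_abs_add_sub_le [IsProbabilityMeasure μ] {r e : Ω → ℝ} (hr : Measurable r)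
    (he : Measurable e) (hre : IndepFun e r μ) {L : ℝ}
    (hL : ∀ u v : ℝ, u ≤ v → μ (r ⁻¹' Set.Icc u v) ≤ ENNReal.ofReal (L * (v - u)))
    (v : ℝ) {t : ℝ} (ht : 0 ≤ t) :
    μ {w | |r w + e w - v| ≤ t} ≤ ENNReal.ofReal (2 * L * t) := by
  have := Measure.isProbabilityMeasure_map (μ := μ) he.aemeasurable
  have := Measure.isProbabilityMeasure_map (μ := μ) hr.aemeasurable
  have hs : MeasurableSet {p : ℝ × ℝ | |p.2 + p.1 - v| ≤ t} :=
    measurableSet_le (by fun_prop) measurable_const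
  have h1 : {w | |r w + e w - v| ≤ t} =
      (fun w => (e w, r w)) ⁻¹' {p : ℝ × ℝ | |p.2 + p.1 - v| ≤ t} := rfl
  rw [h1, ← Measure.map_apply (he.prodMk hr) hs,
    (indepFun_iff_map_prod_eq_prod_map_map he.aemeasurable hr.aemeasurable).mp hre,
    Measure.prod_apply hs]
  calc _ ≤ ∫⁻ _, ENNReal.ofReal (2 * L * t) ∂(μ.map e) := by
        refine lintegral_mono fun x => ?_
        have h2 : Prod.mk x ⁻¹' {p : ℝ × ℝ | |p.2 + p.1 - v| ≤ t} =
            Set.Icc (v - x - t) (v - x + t) := by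
          ext y
          simp only [Set.mem_preimage, Set.mem_ofPred_eq, Set.mem_Icc, abs_le]
          constructor <;> rintro ⟨h, h'⟩ <;> constructor <;> linarith
        rw [h2, Measure.map_apply hr measurableSet_Icc]
        refine (hL _ _ (by linarith)).trans (le_of_eq ?_)
        congr 1
        ring
    _ = _ := by simp

/-- Sums of sub-Gaussian functions of disjoint pairs of independent variables. -/
theorem hasSubgaussianMGF_sum_of_pairs [IsProbabilityMeasure μ] {ι κ : Type*} [DecidableEq ι]
    {f : ι → Ω → ℝ} (hf : ∀ j, Measurable (f j)) (hind : iIndepFun f μ) {p q : κ → ι}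
    (hp : p.Injective) (hq : q.Injective) (hpq : ∀ k l, p k ≠ q l)
    {g : κ → ℝ × ℝ → ℝ} (hg : ∀ k, Measurable (g k)) {c : κ → ℝ≥0}
    (hsub : ∀ k, HasSubgaussianMGF (fun w => g k (f (p k) w, f (q k) w)) (c k) μ)
    (s : Finset κ) :
    HasSubgaussianMGF (fun w => ∑ k ∈ s, g k (f (p k) w, f (q k) w)) (∑ k ∈ s, c k) μ := by
  classical
  induction s using Finset.induction_on with
  | empty => simp
  | insert k s hk ih =>
    simp only [Finset.sum_insert hk]
    refine (hsub k).add_of_indepFun ih ?_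
    have hdis : Disjoint ({p k, q k} : Finset ι) (s.biUnion fun l => {p l, q l}) := by
      rw [Finset.disjoint_left]
      intro j hj hj'
      simp only [Finset.mem_insert, Finset.mem_singleton, Finset.mem_biUnion] at hj hj'
      obtain ⟨l, hl, h⟩ := hj'
      have hkl : k ≠ l := fun h => hk (h ▸ hl)
      rcases hj with rfl | rfl <;> rcases h with h | h
      · exact hkl (hp h)
      · exact hpq _ _ h
      · exact hpq _ _ h.symm
      · exact hkl (hq h)
    have h1 := hind.indepFun_finset _ _ hdis hf
    have hm : ∀ l ∈ s, p l ∈ s.biUnion (fun l => ({p l, q l} : Finset ι)) ∧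
        q l ∈ s.biUnion (fun l => ({p l, q l} : Finset ι)) := fun l hl =>
      ⟨Finset.mem_biUnion.mpr ⟨l, hl, by simp⟩, Finset.mem_biUnion.mpr ⟨l, hl, by simp⟩⟩
    have h2 := h1.comp
      (φ := fun x : ({p k, q k} : Finset ι) → ℝ =>
        g k (x ⟨p k, by simp⟩, x ⟨q k, by simp⟩))
      (ψ := fun x : (s.biUnion fun l => ({p l, q l} : Finset ι)) → ℝ =>
        ∑ l ∈ s.attach, g l.1 (x ⟨p l.1, (hm l.1 l.2).1⟩, x ⟨q l.1, (hm l.1 l.2).2⟩))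
      ((hg k).comp (by fun_prop))
      (Finset.measurable_fun_sum _ fun l _ => (hg l.1).comp (by fun_prop))
    convert! h2 using 1
    ext w
    simp only [Function.comp_apply]
    exact (Finset.sum_attach s fun l => g l (f (p l) w, f (q l) w)).symm

theorem _root_.ProbabilityTheory.HasSubgaussianMGF.of_le {X : Ω → ℝ} {c c' : ℝ≥0}
    (h : HasSubgaussianMGF X c μ) (hc : c ≤ c') : HasSubgaussianMGF X c' μ where
  integrable_exp_mul := h.integrable_exp_mul
  mgf_le t := (h.mgf_le t).trans (by gcongr)

/-- Hoeffding's inequality for weighted indicators of events that depend on disjoint pairs of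
independent variables. -/
theorem measure_weighted_indicator_sum_gt_le [IsProbabilityMeasure μ] {ι κ : Type*}
    [DecidableEq ι] [Fintype κ] {f : ι → Ω → ℝ} (hf : ∀ j, Measurable (f j))
    (hind : iIndepFun f μ) {p q : κ → ι} (hp : p.Injective) (hq : q.Injective)
    (hpq : ∀ k l, p k ≠ q l) {s : κ → Set (ℝ × ℝ)} (hs : ∀ k, MeasurableSet (s k))
    {a : κ → ℝ} (ha : ∀ k, 0 ≤ a k) {P V ε : ℝ} (hP0 : 0 ≤ P) (hε : 0 ≤ ε)
    (hP : ∀ k, μ {w | (f (p k) w, f (q k) w) ∈ s k} ≤ ENNReal.ofReal P)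
    (hV : ∑ k, a k ^ 2 ≤ 4 * V) :
    μ {w | ¬ ∑ k, (s k).indicator (fun _ => a k) (f (p k) w, f (q k) w) ≤
      P * ∑ k, a k + ε} ≤ ENNReal.ofReal (Real.exp (-ε ^ 2 / (2 * V))) := by
  have hV0 : 0 ≤ V := by
    have : 0 ≤ ∑ k, a k ^ 2 := Finset.sum_nonneg fun k _ => sq_nonneg _
    linarith
  set X : κ → Ω → ℝ := fun k w => (s k).indicator (fun _ => a k) (f (p k) w, f (q k) w) with hX
  have hXm : ∀ k, Measurable (X k) := fun k =>
    (measurable_const.indicator (hs k)).comp ((hf _).prodMk (hf _))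
  have hXI : ∀ k w, X k w ∈ Set.Icc 0 (a k) := by
    intro k w
    by_cases h : (f (p k) w, f (q k) w) ∈ s k <;> simp [hX, h, ha k]
  have hmean : ∀ k, ∫ w, X k w ∂μ ≤ P * a k := by
    intro k
    have h1 : ∀ w, X k w = ((fun w => (f (p k) w, f (q k) w)) ⁻¹' s k).indicator
        (fun _ => a k) w := fun w => rfl
    simp only [h1]
    rw [integral_indicator_const _ (((hf _).prodMk (hf _)) (hs k)), smul_eq_mul]
    refine mul_le_mul_of_nonneg_right ?_ (ha k)
    exact ENNReal.toReal_le_of_le_ofReal hP0 (hP k)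
  have hsub := hasSubgaussianMGF_sum_of_pairs hf hind hp hq hpq
    (g := fun k x => (s k).indicator (fun _ => a k) x - ∫ w, X k w ∂μ)
    (fun k => (measurable_const.indicator (hs k)).sub_const _)
    -- Hoeffding's lemma for values in [0, a k] gives the variance proxy (a k)²/4; this is the 4 in
    -- `hV`.
    (c := fun k => (‖a k - 0‖₊ / 2) ^ 2)
    (fun k => hasSubgaussianMGF_of_mem_Icc (hXm k).aemeasurable (.of_forall (hXI k)))
    Finset.univ
  have hc : ∑ k, (‖a k - 0‖₊ / 2) ^ 2 ≤ V.toNNReal := by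
    rw [← NNReal.coe_le_coe, Real.coe_toNNReal _ hV0]
    push_cast
    have : ∀ k, (‖a k - 0‖ / 2) ^ 2 = a k ^ 2 / 4 := fun k => by
      rw [sub_zero, Real.norm_eq_abs, div_pow, sq_abs]; norm_num
    simp only [this, ← Finset.sum_div]
    linarith
  have h1 := (hsub.of_le hc).measure_ge_le hε
  rw [Real.coe_toNNReal _ hV0] at h1
  refine (measure_mono fun w hw => ?_).trans (ENNReal.le_ofReal_iff_toReal_le
    (measure_ne_top _ _) (Real.exp_pos _).le |>.mpr h1)
  simp only [Set.mem_ofPred_eq, not_le, Finset.sum_sub_distrib] at hw ⊢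
  have h2 : ∑ k, ∫ w, X k w ∂μ ≤ P * ∑ k, a k := by
    rw [Finset.mul_sum]
    exact Finset.sum_le_sum fun k _ => hmean k
  linarith

end Probability

/-! ### Grids and their cardinality. -/

section Net

variable {d : ℕ}

/-- The points of a cubic grid with `2 N + 1` points in each of the coordinate intervals
`[-R, R]`. -/
noncomputable def gridPoint (N : ℕ) (R : ℝ) (g : Fin d → Fin (2 * N + 1)) :
    EuclideanSpace ℝ (Fin d) :=
  WithLp.toLp 2 fun j => R / N * ((g j : ℝ) - N)

/-- Rounding each coordinate down to the grid costs at most one spacing R/N, and d coordinates cost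
a factor √d. -/
theorem exists_gridPoint {N : ℕ} (hN : 0 < N) {R : ℝ} (hR : 0 < R)
    {x : EuclideanSpace ℝ (Fin d)} (hx : ‖x‖ ≤ R) :
    ∃ g, ‖x - gridPoint N R g‖ ≤ √d * (R / N) := by
  have hN' : (0 : ℝ) < N := by exact_mod_cast hN
  have hcoord : ∀ j, ∃ i : Fin (2 * N + 1), |x j - R / N * ((i : ℝ) - N)| ≤ R / N := by
    intro j
    have h1 : |x j| ≤ R := by
      rw [← Real.norm_eq_abs]
      exact (PiLp.norm_apply_le x j).trans hx
    rw [abs_le] at h1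
    set z : ℝ := x j * N / R + N with hz
    have hz0 : 0 ≤ z := by
      have : -(N : ℝ) ≤ x j * N / R := by rw [le_div_iff₀ hR]; nlinarith
      linarith
    have hz1 : z ≤ 2 * N := by
      have : x j * N / R ≤ N := by rw [div_le_iff₀ hR]; nlinarith
      linarith
    have hf : ⌊z⌋₊ < 2 * N + 1 := by
      have : ⌊z⌋₊ ≤ 2 * N := by
        refine Nat.floor_le_of_le ?_
        push_cast
        exact hz1
      omega
    refine ⟨⟨⌊z⌋₊, hf⟩, ?_⟩
    have h2 : x j - R / N * ((⌊z⌋₊ : ℝ) - N) = R / N * (z - ⌊z⌋₊) := by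
      rw [hz]; field_simp; ring
    simp only []
    rw [h2, abs_mul, abs_of_pos (by positivity : 0 < R / N)]
    refine mul_le_of_le_one_right (by positivity) ?_
    rw [abs_le]
    constructor <;> linarith [Nat.floor_le hz0, Nat.lt_floor_add_one z]
  choose g hg using hcoord
  refine ⟨g, ?_⟩
  rw [EuclideanSpace.norm_eq]
  refine Real.sqrt_le_iff.mpr ⟨by positivity, ?_⟩
  rw [mul_pow, Real.sq_sqrt (Nat.cast_nonneg d)]
  calc _ ≤ ∑ _j : Fin d, (R / N) ^ 2 := by
        refine Finset.sum_le_sum fun j _ => ?_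
        exact pow_le_pow_left₀ (norm_nonneg _) (hg j) 2
    _ = _ := by simp

/-- The number of pairs of grid points is beaten by the exponential concentration bound. -/
theorem exists_forall_card_mul_exp_le (M : ℕ) {g : ℝ} (hg : 0 < g) :
    ∃ K : ℝ, 0 < K ∧ ∀ n d : ℕ, K ≤ n → K * (d * Real.log d) ≤ n → d ≤ n ∧
      ((2 * (M * n) + 1 : ℕ) : ℝ) ^ (2 * d) * Real.exp (-(g * n)) ≤ K / n := by
  have hlim : ∀ᶠ n : ℕ in Filter.atTop, Real.log ((2 * M + 1) * n) ≤ g / 4 * √n := by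
    have h1 : Real.log =o[Filter.atTop] fun x : ℝ => x ^ (1 / 2 : ℝ) :=
      isLittleO_log_rpow_atTop (by norm_num)
    have h2 : (fun x : ℝ => Real.log ((2 * M + 1) * x)) =o[Filter.atTop]
        fun x : ℝ => √x := by
      have h3 : (fun _ : ℝ => Real.log (2 * M + 1)) =o[Filter.atTop] fun x : ℝ => √x := by
        rw [Asymptotics.isLittleO_const_left]
        right
        exact tendsto_norm_atTop_atTop.comp Real.tendsto_sqrt_atTop
      simp only [← Real.sqrt_eq_rpow] at h1
      refine (h3.add h1).congr' ?_ .rfl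
      filter_upwards [Filter.eventually_gt_atTop 0] with x hx
      rw [Real.log_mul (by positivity) hx.ne']
    have h4 := (h2.bound (by positivity : 0 < g / 4)).natCast_atTop
    filter_upwards [h4] with n hn
    rw [Real.norm_of_nonneg (Real.sqrt_nonneg _)] at hn
    exact (le_abs_self _).trans hn
  obtain ⟨n₀, hn₀⟩ := Filter.eventually_atTop.mp hlim
  set ℓ := Real.log (2 * M + 1) with hℓ
  have hℓ0 : 0 ≤ ℓ := Real.log_nonneg (by
    have : (0 : ℝ) ≤ M := Nat.cast_nonneg M
    linarith)
  -- The summands serve in turn the asymptotic regime n ≥ n₀, the inequality d ≤ n, the final bound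
  -- 2/(gn), and the case d² > n.
  refine ⟨n₀ + 4 + 2 / g + 4 * (2 * ℓ + 2) / g, by positivity, fun n d hn hnd => ?_⟩
  set K : ℝ := n₀ + 4 + 2 / g + 4 * (2 * ℓ + 2) / g with hK
  have p1 : 0 ≤ 2 / g := by positivity
  have p2 : 0 ≤ 4 * (2 * ℓ + 2) / g := by positivity
  have p3 : (0 : ℝ) ≤ n₀ := Nat.cast_nonneg _
  have hn4 : (4 : ℝ) ≤ n := by linarith
  have hn0 : (0 : ℝ) < n := by linarith
  have hlog2 : (1 / 2 : ℝ) ≤ Real.log 2 := by linarith [Real.log_two_gt_d9]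
  have hdn : d ≤ n := by
    rcases Nat.lt_or_ge d 2 with h | h
    · have : 4 ≤ n := by exact_mod_cast hn4
      omega
    · have h1 : Real.log 2 ≤ Real.log d := Real.log_le_log (by norm_num) (by exact_mod_cast h)
      have h2 : (0 : ℝ) ≤ d := Nat.cast_nonneg d
      have h3 : (d : ℝ) * (1 / 2) ≤ d * Real.log d := by
        gcongr
        linarith
      have h4 : 4 * ((d : ℝ) * Real.log d) ≤ K * (d * Real.log d) := by
        have : (0 : ℝ) ≤ d * Real.log d := le_trans (by positivity) h3
        gcongr
        linarith
      have : (d : ℝ) ≤ n := by linarith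
      exact_mod_cast this
  refine ⟨hdn, ?_⟩
  have hcard : ((2 * (M * n) + 1 : ℕ) : ℝ) ≤ (2 * M + 1) * n := by
    push_cast
    nlinarith
  have hexp : (d : ℝ) * Real.log ((2 * M + 1) * n) ≤ g / 4 * n := by
    have hM1 : (0 : ℝ) < 2 * M + 1 := by positivity
    -- If d ≤ √n, then log n = o(√n) suffices. Otherwise log n ≤ 2 log d, and n ≥ K d log d takes
    -- over.
    rcases le_or_gt ((d : ℝ) ^ 2) n with h | h
    · have h1 : (d : ℝ) ≤ √n := Real.le_sqrt_of_sq_le h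
      have h2 : Real.log ((2 * M + 1) * n) ≤ g / 4 * √n := hn₀ n (by
        have : (n₀ : ℝ) ≤ n := by linarith
        exact_mod_cast this)
      calc _ ≤ (d : ℝ) * (g / 4 * √n) := by gcongr
        _ ≤ √n * (g / 4 * √n) := by gcongr
        _ = g / 4 * (√n * √n) := by ring
        _ = _ := by rw [Real.mul_self_sqrt hn0.le]
    · have hd2 : (2 : ℝ) ≤ d := by
        by_contra hlt
        have : (0 : ℝ) ≤ d := Nat.cast_nonneg d
        nlinarith
      have h1 : Real.log n ≤ 2 * Real.log d := by
        have := Real.log_le_log hn0 h.le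
        rwa [Real.log_pow, Nat.cast_ofNat] at this
      have h2 : (1 / 2 : ℝ) ≤ Real.log d := hlog2.trans (Real.log_le_log (by norm_num) hd2)
      rw [Real.log_mul hM1.ne' hn0.ne', ← hℓ]
      have h3 : (d : ℝ) * (ℓ + Real.log n) ≤ (2 * ℓ + 2) * (d * Real.log d) := by
        have : ℓ + Real.log n ≤ (2 * ℓ + 2) * Real.log d := by nlinarith
        calc _ ≤ (d : ℝ) * ((2 * ℓ + 2) * Real.log d) := by gcongr
          _ = _ := by ring
      have h4 : 4 * (2 * ℓ + 2) / g * ((d : ℝ) * Real.log d) ≤ n := by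
        refine le_trans ?_ hnd
        gcongr
        linarith
      refine h3.trans ?_
      have h5 : (2 * ℓ + 2) * (d * Real.log d) =
          g / 4 * (4 * (2 * ℓ + 2) / g * ((d : ℝ) * Real.log d)) := by
        field_simp
      rw [h5]
      gcongr
  have hpow : ((2 * (M * n) + 1 : ℕ) : ℝ) ^ (2 * d) ≤ Real.exp (g / 2 * n) := by
    calc _ ≤ ((2 * M + 1) * n : ℝ) ^ (2 * d) := by gcongr
      _ = Real.exp (2 * d * Real.log ((2 * M + 1) * n)) := by
        rw [show (2 * d * Real.log ((2 * M + 1) * n) : ℝ) =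
          ((2 * d : ℕ) : ℝ) * Real.log ((2 * M + 1) * n) by push_cast; ring,
          Real.exp_nat_mul, Real.exp_log (by positivity)]
      _ ≤ _ := by
        rw [Real.exp_le_exp]
        linarith
  calc _ ≤ Real.exp (g / 2 * n) * Real.exp (-(g * n)) := by gcongr
    _ = (Real.exp (g / 2 * n))⁻¹ := by
      rw [← Real.exp_add, ← Real.exp_neg]; congr 1; ring
    _ ≤ (g / 2 * n)⁻¹ := by
      gcongr
      linarith [Real.add_one_le_exp (g / 2 * n)]
    _ = 2 / g / n := by field_simp
    _ ≤ K / n := by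
      gcongr
      linarith

end Net

end ITLM

/-! ### Uniform control of the selected bad samples with random outputs. -/

namespace ITLM

variable {n d : ℕ} {phi : Fin n → EuclideanSpace ℝ (Fin d)} {link : ℝ → ℝ} {a b : ℝ}

section Probability

variable {Ω : Type*} [MeasurableSpace Ω] {μ : Measure Ω}

/-- Uniformly over finitely many centres and directions, the weight of the bad samples with an
output in a short interval is proportional to its length, up to a small error. -/
theorem measure_uniform_indicator_bound [IsProbabilityMeasure μ] {L B δ : ℝ} (hn : 0 < n)
    (hL : 0 ≤ L) (hB : 0 < B) (hδ : 0 ≤ δ) {Sstar : Finset (Fin n)} {σ : ℝ≥0}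
    {e r : Fin n → Ω → ℝ} (hnoise : IsNoise σ e μ) (hout : IsRandomOutput L Sstar r e μ)
    (hU : ∀ u, ∑ i, (inner ℝ (phi i) u) ^ 2 ≤ B * n * ‖u‖ ^ 2)
    {ι κ : Type*} [Fintype ι] [Fintype κ] (v : ι → Fin n → ℝ) {t : ι → ℝ} (ht : ∀ g, 0 ≤ t g)
    (u : κ → EuclideanSpace ℝ (Fin d)) :
    μ {w | ¬ ∀ g h, ‖u h‖ ≤ 2 →
      ∑ i ∈ Sstarᶜ, (if |r i w + e i w - v g i| ≤ t g then |inner ℝ (phi i) (u h)| else 0) ≤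
        2 * L * t g * ∑ i ∈ Sstarᶜ, |inner ℝ (phi i) (u h)| + n * δ} ≤
    ENNReal.ofReal (Fintype.card ι * Fintype.card κ * Real.exp (-(δ ^ 2 / (2 * B) * n))) := by
  classical
  have hn' : (0 : ℝ) < n := by exact_mod_cast hn
  obtain ⟨hr, hind⟩ := hout
  set f : Fin n ⊕ {i : Fin n // i ∉ Sstar} → Ω → ℝ :=
    fun j : Fin n ⊕ {i : Fin n // i ∉ Sstar} => Sum.elim e (fun i => r i.1) j with hf
  have hfm : ∀ j, Measurable (f j) := by
    rintro (j | j)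
    · exact hnoise.1 j
    · exact (hr j.1 j.2).1
  have hsum : ∀ F : Fin n → ℝ, ∑ i ∈ Sstarᶜ, F i = ∑ k : {i : Fin n // i ∉ Sstar}, F k.1 :=
    fun F => Finset.sum_subtype _ (fun i => by simp) F
  have hone : ∀ p : ι × κ, μ {w | ¬ (‖u p.2‖ ≤ 2 →
      ∑ i ∈ Sstarᶜ, (if |r i w + e i w - v p.1 i| ≤ t p.1 then
        |inner ℝ (phi i) (u p.2)| else 0) ≤
        2 * L * t p.1 * ∑ i ∈ Sstarᶜ, |inner ℝ (phi i) (u p.2)| + n * δ)} ≤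
      ENNReal.ofReal (Real.exp (-(δ ^ 2 / (2 * B) * n))) := by
    rintro ⟨g, h⟩
    by_cases hu : ‖u h‖ ≤ 2
    swap
    · simp [hu]
    -- The restriction ‖u‖ ≤ 2 keeps the sum of squared weights below 4Bn; grid points of the unit
    -- cube can have norm up to √d.
    have hV : ∑ k : {i : Fin n // i ∉ Sstar}, |inner ℝ (phi k.1) (u h)| ^ 2 ≤
        4 * (B * n) := by
      simp only [sq_abs]
      rw [← hsum fun i => (inner ℝ (phi i) (u h)) ^ 2]
      refine (Finset.sum_le_univ_sum_of_nonneg fun i => sq_nonneg _).trans ((hU _).trans ?_)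
      have : ‖u h‖ ^ 2 ≤ 2 ^ 2 := by gcongr
      calc _ ≤ B * n * 2 ^ 2 := by gcongr
        _ = _ := by ring
    have key := measure_weighted_indicator_sum_gt_le (μ := μ) hfm hind
      (p := fun k : {i : Fin n // i ∉ Sstar} => Sum.inl k.1) (q := Sum.inr)
      (Sum.inl_injective.comp Subtype.val_injective) Sum.inr_injective (by simp)
      (s := fun k => {x : ℝ × ℝ | |x.2 + x.1 - v g k.1| ≤ t g})
      (fun k => measurableSet_le (by fun_prop) measurable_const)
      (a := fun k => |inner ℝ (phi k.1) (u h)|) (fun k => abs_nonneg _)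
      (P := 2 * L * t g) (V := B * n) (ε := n * δ) (by have := ht g; positivity) (by positivity)
      (fun k => measure_abs_add_sub_le (hr k.1 k.2).1 (hnoise.1 k.1)
        (hind.indepFun (i := Sum.inl k.1) (j := Sum.inr k) (by simp)) (hr k.1 k.2).2.2 _ (ht g))
      hV
    have hexp : -(n * δ) ^ 2 / (2 * (B * n)) = -(δ ^ 2 / (2 * B) * n) := by field_simp
    rw [hexp] at key
    refine (measure_mono fun w hw => ?_).trans key
    simp only [Set.mem_ofPred_eq, hu, true_imp_iff, hsum] at hw ⊢
    intro hle
    refine hw (le_trans (le_of_eq ?_) hle)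
    refine Finset.sum_congr rfl fun k _ => ?_
    simp [Set.indicator_apply, hf]
  calc _ ≤ μ (⋃ p : ι × κ, {w | ¬ (‖u p.2‖ ≤ 2 →
      ∑ i ∈ Sstarᶜ, (if |r i w + e i w - v p.1 i| ≤ t p.1 then
        |inner ℝ (phi i) (u p.2)| else 0) ≤
        2 * L * t p.1 * ∑ i ∈ Sstarᶜ, |inner ℝ (phi i) (u p.2)| + n * δ)}) := by
        refine measure_mono fun w hw => ?_
        simp only [Set.mem_ofPred_eq, not_forall] at hw
        obtain ⟨g, h, hu, hw⟩ := hw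
        exact Set.mem_iUnion.mpr ⟨(g, h), fun hc => hw (hc hu)⟩
    _ ≤ ∑ p : ι × κ, _ := measure_iUnion_fintype_le _ _
    _ ≤ ∑ _p : ι × κ, ENNReal.ofReal (Real.exp (-(δ ^ 2 / (2 * B) * n))) :=
        Finset.sum_le_sum fun p _ => hone p
    _ = _ := by
        rw [Finset.sum_const, Finset.card_univ, Fintype.card_prod, nsmul_eq_mul,
          ENNReal.ofReal_mul (by positivity), ← Nat.cast_mul, ENNReal.ofReal_natCast]

end Probability

variable {θ θstar : EuclideanSpace ℝ (Fin d)} {Sstar S : Finset (Fin n)} {r e : Fin n → ℝ}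

theorem residualRadius_nonneg {B γ b σ x : ℝ} (hb : 0 ≤ b) (hσ : 0 ≤ σ) (hx : 0 ≤ x) :
    0 ≤ residualRadius B γ b σ x :=
  mul_nonneg (Real.sqrt_nonneg _) (by positivity)

theorem sum_abs_inner_le {B : ℝ} (hB : 0 ≤ B)
    (hU : ∀ u, ∑ i, (inner ℝ (phi i) u) ^ 2 ≤ B * n * ‖u‖ ^ 2) (P : Finset (Fin n))
    (u : EuclideanSpace ℝ (Fin d)) : ∑ i ∈ P, |inner ℝ (phi i) u| ≤ n * (√B * ‖u‖) := by
  refine (Finset.sum_le_univ_sum_of_nonneg fun i => abs_nonneg _).trans ?_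
  refine abs_le_of_sq_le_sq' ?_ (by positivity) |>.2
  refine sq_sum_le_card_mul_sum_sq.trans ?_
  simp only [sq_abs, Finset.card_univ, Fintype.card_fin]
  calc _ ≤ (n : ℝ) * (B * n * ‖u‖ ^ 2) := by gcongr; exact hU u
    _ = _ := by rw [mul_pow, mul_pow, Real.sq_sqrt hB]; ring

/-- The contribution of the selected bad samples at an arbitrary iterate, from the bounds at the
points of a grid. -/
theorem norm_bad_sum_le_of_grid {B γ σ R L δ ν : ℝ} {N : ℕ} (hl : IsLink a b link) (ha : 0 < a)
    (hab : a ≤ b) (hB : 0 ≤ B) (hσ : 0 ≤ σ) (hL : 0 ≤ L) (hδ : 0 ≤ δ) (hR : 0 < R) (hN : 0 < N)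
    (hU : ∀ u, ∑ i, (inner ℝ (phi i) u) ^ 2 ≤ B * n * ‖u‖ ^ 2)
    (hgrid : ∀ (g h : Fin d → Fin (2 * N + 1)), ‖gridPoint N 1 h‖ ≤ 2 →
      ∑ i ∈ Sstarᶜ, (if |r i + e i - link (inner ℝ (phi i) (θstar + gridPoint N R g))| ≤
          residualRadius B γ b σ ‖gridPoint N R g‖ + ν
        then |inner ℝ (phi i) (gridPoint N 1 h)| else 0) ≤
      2 * L * (residualRadius B γ b σ ‖gridPoint N R g‖ + ν) *
        ∑ i ∈ Sstarᶜ, |inner ℝ (phi i) (gridPoint N 1 h)| + n * δ)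
    (hρ : ∀ i ∈ S, |output link phi Sstar θstar r e i - link (inner ℝ (phi i) θ)| ≤
      residualRadius B γ b σ ‖θ - θstar‖)
    (hN1 : √d * (1 / N) ≤ 1 / 2)
    (hNν : b * (√((2 * B + 18) / γ) + √(B * n)) * (√d * (R / N)) ≤ ν)
    (hθ : ‖θ - θstar‖ ≤ R) :
    ‖∑ i ∈ S \ Sstar, ((output link phi Sstar θstar r e i - link (inner ℝ (phi i) θ)) *
        deriv link (inner ℝ (phi i) θ)) • phi i‖ ≤
      n * (b * (residualRadius B γ b σ ‖θ - θstar‖ *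
        (8 * L * √B * (residualRadius B γ b σ ‖θ - θstar‖ + 2 * ν) + 2 * δ))) := by
  have hb : 0 < b := ha.trans_le hab
  set T := residualRadius B γ b σ ‖θ - θstar‖ with hT
  have hT0 : 0 ≤ T := residualRadius_nonneg hb.le hσ (norm_nonneg _)
  set C := √((2 * B + 18) / γ) with hC
  have hC0 : 0 ≤ C := Real.sqrt_nonneg _
  obtain ⟨g, hg⟩ := exists_gridPoint hN hR hθ
  set p := gridPoint N R g with hp
  set q := √d * (R / N) with hq
  have hq0 : 0 ≤ q := by positivity
  have hν0 : 0 ≤ ν := le_trans (by positivity) hNν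
  have hCq : C * (b * q) + b * (√(B * n) * q) ≤ ν := by
    refine le_trans (le_of_eq ?_) hNν
    ring
  have hCq1 : C * (b * q) ≤ ν := by
    have : 0 ≤ b * (√(B * n) * q) := by positivity
    linarith
  have hTp : T ≤ residualRadius B γ b σ ‖p‖ + C * (b * q) := by
    have h1 : ‖θ - θstar‖ ≤ ‖p‖ + q := by
      have := norm_sub_norm_le (θ - θstar) p
      linarith
    rw [hT, residualRadius, residualRadius, ← hC, ← mul_add]
    refine mul_le_mul_of_nonneg_left ?_ hC0
    nlinarith
  have hpT : residualRadius B γ b σ ‖p‖ ≤ T + ν := by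
    have h1 : ‖p‖ ≤ ‖θ - θstar‖ + q := by
      have := norm_sub_norm_le p (θ - θstar)
      rw [norm_sub_rev p] at this
      linarith
    have h2 : residualRadius B γ b σ ‖p‖ ≤ T + C * (b * q) := by
      rw [hT, residualRadius, residualRadius, ← hC, ← mul_add]
      refine mul_le_mul_of_nonneg_left ?_ hC0
      nlinarith
    linarith
  -- The events must not depend on θ, so both the centre and the radius are moved to the grid point
  -- p; the slack ν pays for the two changes.
  have hmem : ∀ i ∈ S \ Sstar, |r i + e i - link (inner ℝ (phi i) (θstar + p))| ≤
      residualRadius B γ b σ ‖p‖ + ν := by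
    intro i hi
    rw [Finset.mem_sdiff] at hi
    have h1 := hρ i hi.1
    simp only [output, hi.2, if_false] at h1
    have h2 := hl.abs_sub_le ha (inner ℝ (phi i) θ) (inner ℝ (phi i) (θstar + p))
    rw [← inner_sub_right, ← sub_sub] at h2
    have h3 : |inner ℝ (phi i) (θ - θstar - p)| ≤ √(B * n) * q := by
      have h4 : (inner ℝ (phi i) (θ - θstar - p)) ^ 2 ≤ B * n * q ^ 2 :=
        (Finset.single_le_sum (f := fun i => (inner ℝ (phi i) (θ - θstar - p)) ^ 2)
          (fun i _ => sq_nonneg _) (Finset.mem_univ i)).trans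
          ((hU _).trans (by gcongr))
      refine abs_le_of_sq_le_sq (h4.trans (le_of_eq ?_)) (by positivity)
      rw [mul_pow √(B * n) q, Real.sq_sqrt (by positivity : 0 ≤ B * n)]
    have h5 : b * |inner ℝ (phi i) (θ - θstar - p)| ≤ b * (√(B * n) * q) := by gcongr
    have h6 := abs_sub_le (r i + e i) (link (inner ℝ (phi i) θ))
      (link (inner ℝ (phi i) (θstar + p)))
    linarith
  set x := ∑ i ∈ S \ Sstar, ((output link phi Sstar θstar r e i - link (inner ℝ (phi i) θ)) *
        deriv link (inner ℝ (phi i) θ)) • phi i with hx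
  by_cases hx0 : x = 0
  · rw [hx0, norm_zero]
    positivity
  have hxpos : 0 < ‖x‖ := norm_pos_iff.mpr hx0
  set z := ‖x‖⁻¹ • x with hz
  have hz1 : ‖z‖ = 1 := by rw [hz, norm_smul, norm_inv, norm_norm, inv_mul_cancel₀ hxpos.ne']
  obtain ⟨h, hh⟩ := exists_gridPoint hN one_pos hz1.le
  set y := gridPoint N 1 h with hy
  have hzy : ‖z - y‖ ≤ 1 / 2 := hh.trans hN1
  have hy2 : ‖y‖ ≤ 2 := by
    have := norm_sub_norm_le y z
    rw [norm_sub_rev] at this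
    linarith
  have hxz : inner ℝ x z = ‖x‖ := by
    rw [hz, real_inner_smul_right, real_inner_self_eq_norm_sq]
    field_simp
  -- A grid point within 1/2 of the direction of x recovers half of its norm, so finitely many
  -- directions suffice.
  have hxy : ‖x‖ ≤ 2 * inner ℝ x y := by
    have h1 := real_inner_le_norm x (z - y)
    rw [inner_sub_right, hxz] at h1
    have h2 : ‖x‖ * ‖z - y‖ ≤ ‖x‖ * (1 / 2) := by gcongr
    linarith
  have hxy2 : inner ℝ x y ≤ b * T * ∑ i ∈ S \ Sstar, |inner ℝ (phi i) y| := by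
    rw [hx, sum_inner, Finset.mul_sum]
    refine Finset.sum_le_sum fun i hi => ?_
    rw [real_inner_smul_left]
    refine (le_abs_self _).trans ?_
    rw [abs_mul]
    refine mul_le_mul_of_nonneg_right ?_ (abs_nonneg _)
    have h1 := hl.2.2 (inner ℝ (phi i) θ)
    rw [abs_mul, abs_of_pos (ha.trans_le h1.1), mul_comm]
    exact mul_le_mul h1.2 (hρ i (Finset.mem_sdiff.mp hi).1) (abs_nonneg _) hb.le
  have hsum : ∑ i ∈ S \ Sstar, |inner ℝ (phi i) y| ≤
      ∑ i ∈ Sstarᶜ, (if |r i + e i - link (inner ℝ (phi i) (θstar + p))| ≤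
          residualRadius B γ b σ ‖p‖ + ν then |inner ℝ (phi i) y| else 0) := by
    calc _ = ∑ i ∈ S \ Sstar, (if |r i + e i - link (inner ℝ (phi i) (θstar + p))| ≤
          residualRadius B γ b σ ‖p‖ + ν then |inner ℝ (phi i) y| else 0) :=
          Finset.sum_congr rfl fun i hi => by rw [if_pos (hmem i hi)]
      _ ≤ _ := by
          refine Finset.sum_le_sum_of_subset_of_nonneg (fun i hi => ?_) fun i _ _ => ?_
          · rw [Finset.mem_compl]
            exact (Finset.mem_sdiff.mp hi).2
          · split_ifs
            exacts [abs_nonneg _, le_rfl]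
  have hfin : ∑ i ∈ S \ Sstar, |inner ℝ (phi i) y| ≤
      n * (4 * L * √B * (T + 2 * ν) + δ) := by
    refine (hsum.trans (hgrid g h hy2)).trans ?_
    have h1 : ∑ i ∈ Sstarᶜ, |inner ℝ (phi i) y| ≤ n * (√B * 2) :=
      (sum_abs_inner_le hB hU _ y).trans (by gcongr)
    have h2 : 0 ≤ residualRadius B γ b σ ‖p‖ + ν :=
      add_nonneg (residualRadius_nonneg hb.le hσ (norm_nonneg _)) hν0
    calc _ ≤ 2 * L * (T + ν + ν) * (n * (√B * 2)) + n * δ := by gcongr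
      _ = _ := by ring
  calc ‖x‖ ≤ 2 * (b * T * (n * (4 * L * √B * (T + 2 * ν) + δ))) := by
        refine hxy.trans (mul_le_mul_of_nonneg_left (hxy2.trans ?_) (by norm_num))
        gcongr
    _ = _ := by ring

end ITLM

/-! ### Assembling the one-round bounds. -/

namespace ITLM

variable {n d : ℕ} {phi : Fin n → EuclideanSpace ℝ (Fin d)} {link : ℝ → ℝ} {a b : ℝ}
  {θ θstar : EuclideanSpace ℝ (Fin d)} {Sstar S : Finset (Fin n)} {r e : Fin n → ℝ}

/-- The facts about one round on the event that the noise vector has its typical size. -/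
theorem IsTrimmedSet.one_step {c₀ A B α ε η σ : ℝ} (hA : 0 < A) (hB : 0 < B) (hc₀ : 0 < c₀)
    (hα : c₀ ≤ α) (hα1 : α < 1) (hε1 : 2 * ε ≤ 1 - α)
    (hε2 : 4 * ε * B ≤ (1 - α) * (A ^ 2 / B)) (hn : 0 < n) (hreg : IsRegular c₀ A B phi)
    (hclean : 1 - ε < cleanFraction Sstar) (hl : IsLink a b link) (ha : 0 < a) (hab : a ≤ b)
    (hη : 0 ≤ η) (hη1 : 4 * η / α * (b ^ 4 * B ^ 2) ≤ a ^ 2 * (A ^ 2 / B / 2))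
    (hη2 : 4 * η / α * (a ^ 2 * (A ^ 2 / B / 2)) ≤ 1) (hσ : 0 ≤ σ)
    (he : ∑ i, e i ^ 2 ≤ 9 * n * σ ^ 2)
    (hS : IsTrimmedSet link phi (output link phi Sstar θstar r e) α θ S) :
    (∀ i ∈ S, |output link phi Sstar θstar r e i - link (inner ℝ (phi i) θ)| ≤
      residualRadius B ((1 - α) / 2) b σ ‖θ - θstar‖) ∧
    ((S \ Sstar).card : ℝ) ≤ ε * n ∧
    ∀ Z, ‖∑ i ∈ S \ Sstar, ((output link phi Sstar θstar r e i - link (inner ℝ (phi i) θ)) *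
        deriv link (inner ℝ (phi i) θ)) • phi i‖ ≤ n * (b * Z) →
      ‖θstar - modelUpdate link phi (output link phi Sstar θstar r e) η S θ‖ ≤
        (1 - η * (a ^ 2 * (A ^ 2 / B / 2))) * ‖θ - θstar‖ +
          4 * η / α * (b * (√(9 * B) * σ)) + 4 * η / α * (b * Z) := by
  have hn' : (0 : ℝ) < n := by exact_mod_cast hn
  have hα0 : 0 < α := hc₀.trans_le hα
  have hU := hreg.sum_sq_le (hα.trans hα1.le)
  have hkn : (S.card : ℝ) ≤ α * n := by
    rw [hS.1]
    exact Nat.floor_le (by positivity)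
  have hk0 : 0 < S.card := by
    rw [hS.1]
    exact hreg.floor_pos hA hα hα1.le hn
  have hkα : α / 2 * n ≤ S.card := by
    have h1 := Nat.lt_floor_add_one (α * n)
    rw [← hS.1] at h1
    have h2 : (1 : ℝ) ≤ S.card := by exact_mod_cast hk0
    linarith
  have hSs : (1 - ε) * n ≤ Sstar.card := by
    rw [cleanFraction, lt_div_iff₀ hn'] at hclean
    exact hclean.le
  have hbad : ((S \ Sstar).card : ℝ) ≤ ε * n := by
    have h1 : (S \ Sstar).card + Sstar.card ≤ n := by
      have := (Finset.card_union_of_disjoint (Finset.sdiff_disjoint (s := Sstar) (t := S))).symm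
      rw [this]
      exact (Finset.card_le_univ _).trans (by simp)
    have h2 : ((S \ Sstar).card : ℝ) + Sstar.card ≤ n := by exact_mod_cast h1
    linarith
  have hG : ∀ u, A ^ 2 / B / 2 * n * ‖u‖ ^ 2 ≤ ∑ i ∈ S ∩ Sstar, (inner ℝ (phi i) u) ^ 2 := by
    refine le_sum_sq_of_card_ge (γ := 1 - α) (ε := ε) (k := S.card) hB.le (by linarith) hU
      (fun S' hS' u => hreg.le_sum_sq hA hB hα hα1.le hn S' (hS'.trans hS.1) u) (by linarith)
      hε2 ?_ (Finset.card_le_card Finset.inter_subset_left)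
    have h1 := Finset.card_inter_add_card_sdiff S Sstar
    have h2 : ((S ∩ Sstar).card : ℝ) + (S \ Sstar).card = S.card := by exact_mod_cast h1
    linarith
  refine ⟨fun i hi => abs_residual_le hl ha hab hB.le (by linarith) hσ hn hU he hS ?_ hi, hbad,
    fun Z hZ => norm_modelUpdate_sub_le hl ha hab hB.le (by positivity) hη hσ hn hα0 hU hG he
      hη1 hη2 hkα hZ⟩
  nlinarith

/-- The radius C(b‖Δ‖ + σ) is split: its ‖Δ‖ part is charged to the contraction factor (`hκ1`, with
half of a²D to spare), its σ part joins the noise term and is charged to b√κσ (`hκ2`). The ξ term is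
nonnegative and is dropped. -/
theorem stepBound_of_norm_le {B D α γ η σ κ V : ℝ} {θ' : EuclideanSpace ℝ (Fin d)}
    (hb : 0 ≤ b) (hη : 0 ≤ η) (hσ : 0 ≤ σ)
    (h : ‖θstar - θ'‖ ≤ (1 - η * (a ^ 2 * D)) * ‖θ - θstar‖ +
      4 * η / α * (b * (√(9 * B) * σ)) +
      4 * η / α * (b * (residualRadius B γ b σ ‖θ - θstar‖ * V)))
    (hκ1 : 4 / α * √((2 * B + 18) / γ) * b ^ 2 * V ≤ a ^ 2 * D / 2 + D / 2 * κ * b ^ 2)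
    (hκ2 : η * (4 / α * (√(9 * B) + √((2 * B + 18) / γ) * V)) * σ ≤ √κ * σ) :
    StepBound phi (D / 2) 1 a b η σ κ θstar θ θ' := by
  rw [StepBound]
  refine h.trans ?_
  have hxi : 0 ≤ η * b * xi phi / n * σ := by
    have : 0 ≤ xi phi := Real.sqrt_nonneg _
    positivity
  rw [residualRadius]
  set C := √((2 * B + 18) / γ)
  set X := ‖θ - θstar‖
  have hX : 0 ≤ η * X := mul_nonneg hη (norm_nonneg _)
  have h1 := mul_le_mul_of_nonneg_left hκ1 hX
  have h2 := mul_le_mul_of_nonneg_left hκ2 hb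
  have h3 : (1 - η * (a ^ 2 * D)) * X + 4 * η / α * (b * (√(9 * B) * σ)) +
      4 * η / α * (b * (C * (b * X + σ) * V)) =
      (1 - η * (a ^ 2 * D)) * X + b * (η * (4 / α * (√(9 * B) + C * V)) * σ) +
        η * X * (4 / α * C * b ^ 2 * V) := by ring
  rw [h3]
  nlinarith

theorem exists_step_size {x₁ x₂ x₃ y₁ y₂ y₃ : ℝ} (hx₁ : 0 ≤ x₁) (hx₂ : 0 ≤ x₂) (hx₃ : 0 ≤ x₃)
    (hy₁ : 0 < y₁) (hy₂ : 0 < y₂) (hy₃ : 0 < y₃) :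
    ∃ η₀ : ℝ, 0 < η₀ ∧ ∀ η : ℝ, 0 < η → η ≤ η₀ → η * x₁ ≤ y₁ ∧ η * x₂ ≤ y₂ ∧ η * x₃ ≤ y₃ := by
  have key : ∀ {x y η : ℝ}, 0 ≤ x → 0 < y → 0 < η → η ≤ y / (x + 1) → η * x ≤ y := by
    intro x y η hx hy hη h
    rw [le_div_iff₀ (by positivity)] at h
    nlinarith
  refine ⟨min (y₁ / (x₁ + 1)) (min (y₂ / (x₂ + 1)) (y₃ / (x₃ + 1))), by positivity,
    fun η hη h => ⟨key hx₁ hy₁ hη (h.trans (min_le_left _ _)),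
      key hx₂ hy₂ hη (h.trans ((min_le_right _ _).trans (min_le_left _ _))),
      key hx₃ hy₃ hη (h.trans ((min_le_right _ _).trans (min_le_right _ _)))⟩⟩

/-- One round with adversarial outputs of the bad samples. -/
theorem arbitrary_outputs_step {c₀ A B α ε : ℝ} (hc₀ : 0 < c₀) (hA : 0 < A) (hB : 0 < B)
    (hα : c₀ ≤ α) (hα1 : α < 1) (hε0 : 0 ≤ ε) (hε1 : 2 * ε ≤ 1 - α)
    (hε2 : 4 * ε * B ≤ (1 - α) * (A ^ 2 / B))
    (hε3 : 16 * √((2 * B + 18) / ((1 - α) / 2)) * √(ε * B) ≤ α * (A ^ 2 / B / 2))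
    {a b : ℝ} (ha : 0 < a) (hab : a ≤ b) :
    ∃ η₀ : ℝ, 0 < η₀ ∧
      ∀ (σ : ℝ≥0) (n d : ℕ), 0 < n →
      ∀ phi : Fin n → EuclideanSpace ℝ (Fin d), IsRegular c₀ A B phi →
      ∀ Sstar : Finset (Fin n), 1 - ε < cleanFraction Sstar →
      ∀ link : ℝ → ℝ, IsLink a b link →
      ∀ (θstar : EuclideanSpace ℝ (Fin d)) (η : ℝ), 0 < η → η ≤ η₀ →
      ∀ e : Fin n → ℝ, ∑ i, e i ^ 2 ≤ 9 * n * (σ : ℝ) ^ 2 →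
      ∀ (r : Fin n → ℝ) (θ : EuclideanSpace ℝ (Fin d)) (S : Finset (Fin n)),
        IsTrimmedSet link phi (output link phi Sstar θstar r e) α θ S →
        StepBound phi (A ^ 2 / B / 2 / 2) 1 a b η σ (1 / 2) θstar θ
          (modelUpdate link phi (output link phi Sstar θstar r e) η S θ) := by
  have hα0 : 0 < α := hc₀.trans_le hα
  have hb : 0 < b := ha.trans_le hab
  obtain ⟨η₀, hη₀, h⟩ := exists_step_size (x₁ := 4 / α * (b ^ 4 * B ^ 2))
    (x₂ := 4 / α * (a ^ 2 * (A ^ 2 / B / 2)))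
    (x₃ := 4 / α * (√(9 * B) + √((2 * B + 18) / ((1 - α) / 2)) * √(ε * B)))
    (y₁ := a ^ 2 * (A ^ 2 / B / 2)) (y₂ := 1) (y₃ := √(1 / 2)) (by positivity) (by positivity)
    (by positivity) (by positivity) one_pos (by positivity)
  refine ⟨η₀, hη₀, fun σ n d hn phi hreg Sstar hclean link hl θstar η hη hηle e he r θ S hS => ?_⟩
  obtain ⟨h1, h2, h3⟩ := h η hη hηle
  obtain ⟨hρ, hbad, hstep⟩ := hS.one_step hA hB hc₀ hα hα1 hε1 hε2 hn hreg hclean hl ha hab hη.le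
    (le_trans (le_of_eq (by ring)) h1) (le_trans (le_of_eq (by ring)) h2) σ.coe_nonneg he
  refine stepBound_of_norm_le hb.le hη.le σ.coe_nonneg (hstep _
    (norm_bad_sum_le hl ha hab hB.le
      (residualRadius_nonneg hb.le σ.coe_nonneg (norm_nonneg _)) hε0 hbad
      (hreg.sum_sq_le (hα.trans hα1.le)) fun i hi => hρ i (Finset.mem_sdiff.mp hi).1)) ?_
    (mul_le_mul_of_nonneg_right h3 σ.coe_nonneg)
  -- Scaling by b²/(4α) turns the smallness of ε into the slope condition for κ = 1/2.
  have h4 := mul_le_mul_of_nonneg_right hε3 (by positivity : 0 ≤ b ^ 2 / (4 * α))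
  have h5 : 16 * √((2 * B + 18) / ((1 - α) / 2)) * √(ε * B) * (b ^ 2 / (4 * α)) =
      4 / α * √((2 * B + 18) / ((1 - α) / 2)) * b ^ 2 * √(ε * B) := by
    field_simp
    ring
  have h6 : α * (A ^ 2 / B / 2) * (b ^ 2 / (4 * α)) = A ^ 2 / B / 2 / 2 * (1 / 2) * b ^ 2 := by
    field_simp
    ring
  rw [h5, h6] at h4
  have : 0 ≤ a ^ 2 * (A ^ 2 / B / 2) / 2 := by positivity
  linarith

/-- Writing bX = a · (b/a)X gives bX + σ ≤ (a + 1)(b/a)Q, which is why c can depend on a but not on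
b. The constant part V₀ uses up the spare a²D/2. -/
theorem slope_le_of_constants {B D α σ L c V₀ C V X Q : ℝ} (ha : 0 < a) (hb : 0 < b)
    (hα : 0 < α) (hL : 0 ≤ L) (hC : 0 ≤ C) (hQ : 0 ≤ Q) (hX : X ≤ Q)
    (hσ : σ ≤ b / a * Q) (hV₀ : 4 / α * C * b ^ 2 * V₀ ≤ a ^ 2 * D / 2)
    (hc : (a + 1) * (32 / α * C ^ 2 * L * √B) ≤ D / 2 * c)
    (hV : V ≤ 8 * L * √B * (C * (b * X + σ)) + V₀) :
    4 / α * C * b ^ 2 * V ≤ a ^ 2 * D / 2 + D / 2 * (c * (b / a * Q)) * b ^ 2 := by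
  have h1 : b * X + σ ≤ (a + 1) * (b / a * Q) := by
    have h2 : b * X = a * (b / a * X) := by field_simp
    have h3 : b / a * X ≤ b / a * Q := by gcongr
    rw [h2]
    nlinarith
  calc 4 / α * C * b ^ 2 * V
      ≤ 4 / α * C * b ^ 2 * (8 * L * √B * (C * (b * X + σ)) + V₀) := by gcongr
    _ = 4 / α * C * b ^ 2 * V₀ + 32 / α * C ^ 2 * L * √B * (b * X + σ) * b ^ 2 := by ring
    _ ≤ a ^ 2 * D / 2 + 32 / α * C ^ 2 * L * √B * ((a + 1) * (b / a * Q)) * b ^ 2 := by gcongr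
    _ = a ^ 2 * D / 2 + (a + 1) * (32 / α * C ^ 2 * L * √B) * (b / a * Q * b ^ 2) := by ring
    _ ≤ a ^ 2 * D / 2 + D / 2 * c * (b / a * Q * b ^ 2) := by gcongr
    _ = _ := by ring

/-- The bound for one round on the event that the noise is of typical size and that the bad
samples are spread out at the points of a grid. -/
theorem stepBound_of_grid {c₀ A B α ε η σ L R δ ν c V₀ C D : ℝ} {N : ℕ}
    (hA : 0 < A) (hB : 0 < B) (hc₀ : 0 < c₀)
    (hα : c₀ ≤ α) (hα1 : α < 1) (hε1 : 2 * ε ≤ 1 - α)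
    (hε2 : 4 * ε * B ≤ (1 - α) * (A ^ 2 / B)) (hn : 0 < n) (hreg : IsRegular c₀ A B phi)
    (hclean : 1 - ε < cleanFraction Sstar) (hl : IsLink a b link) (ha : 0 < a) (hab : a ≤ b)
    (hD : D = A ^ 2 / B / 2) (hC : C = √((2 * B + 18) / ((1 - α) / 2)))
    (hη : 0 ≤ η) (hη1 : 4 * η / α * (b ^ 4 * B ^ 2) ≤ a ^ 2 * D)
    (hη2 : 4 * η / α * (a ^ 2 * D) ≤ 1) (hσ : 0 ≤ σ)
    (hη3 : η * (4 / α * (√(9 * B) + C * √B)) * σ ≤ √(c * σ) * σ)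
    (he : ∑ i, e i ^ 2 ≤ 9 * n * σ ^ 2) (hL : 0 ≤ L) (hδ : 0 ≤ δ) (hV₀0 : 0 ≤ V₀)
    (hV₀ : 16 * L * √B * ν + 2 * δ = V₀) (hV₀' : 4 / α * C * b ^ 2 * V₀ ≤ a ^ 2 * D / 2)
    (hc : (a + 1) * (32 / α * C ^ 2 * L * √B) ≤ D / 2 * c) (hc0 : 0 ≤ c)
    (hR0 : 0 < R) (hR : 1 ≤ 8 * L * (C * (b * R))) (hN : 0 < N)
    (hgrid : ∀ (g h : Fin d → Fin (2 * N + 1)), ‖gridPoint N 1 h‖ ≤ 2 →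
      ∑ i ∈ Sstarᶜ, (if |r i + e i - link (inner ℝ (phi i) (θstar + gridPoint N R g))| ≤
          residualRadius B ((1 - α) / 2) b σ ‖gridPoint N R g‖ + ν
        then |inner ℝ (phi i) (gridPoint N 1 h)| else 0) ≤
      2 * L * (residualRadius B ((1 - α) / 2) b σ ‖gridPoint N R g‖ + ν) *
        ∑ i ∈ Sstarᶜ, |inner ℝ (phi i) (gridPoint N 1 h)| + n * δ)
    (hN1 : √d * (1 / N) ≤ 1 / 2) (hNν : b * (C + √(B * n)) * (√d * (R / N)) ≤ ν)
    (hS : IsTrimmedSet link phi (output link phi Sstar θstar r e) α θ S) :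
    StepBound phi (D / 2) 1 a b η σ (c * (b / a * √(‖θ - θstar‖ ^ 2 + σ ^ 2))) θstar θ
      (modelUpdate link phi (output link phi Sstar θstar r e) η S θ) := by
  subst hD hC
  have hα0 : 0 < α := hc₀.trans_le hα
  have hb : 0 < b := ha.trans_le hab
  have hU := hreg.sum_sq_le (hα.trans hα1.le)
  obtain ⟨hρ, -, hstep⟩ := hS.one_step hA hB hc₀ hα hα1 hε1 hε2 hn hreg hclean hl ha hab hη
    hη1 hη2 hσ he
  have hX0 : 0 ≤ ‖θ - θstar‖ := norm_nonneg _
  have hT0 := residualRadius_nonneg (B := B) (γ := (1 - α) / 2) hb.le hσ hX0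
  -- Both bounds are kept through a minimum: √B keeps the noise condition uniform in θ, the other
  -- entry gives the slope.
  have hbadV : ‖∑ i ∈ S \ Sstar, ((output link phi Sstar θstar r e i -
      link (inner ℝ (phi i) θ)) * deriv link (inner ℝ (phi i) θ)) • phi i‖ ≤
      n * (b * (residualRadius B ((1 - α) / 2) b σ ‖θ - θstar‖ *
        min √B (8 * L * √B * residualRadius B ((1 - α) / 2) b σ ‖θ - θstar‖ + V₀))) := by
    have htriv := norm_bad_sum_le (θ := θ) (P := S \ Sstar) hl ha hab hB.le hT0 zero_le_one
      (by
        rw [one_mul]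
        exact_mod_cast (Finset.card_le_univ _).trans (by simp)) hU
      fun i hi => hρ i (Finset.mem_sdiff.mp hi).1
    rw [one_mul] at htriv
    rcases le_or_gt ‖θ - θstar‖ R with hle | hgt
    · have hg := norm_bad_sum_le_of_grid hl ha hab hB.le hσ hL hδ hR0 hN hU
        hgrid hρ hN1 hNν hle
      rw [mul_add (8 * L * √B), add_assoc, show 8 * L * √B * (2 * ν) + 2 * δ = V₀ by linarith] at hg
      rcases min_choice √B
        (8 * L * √B * residualRadius B ((1 - α) / 2) b σ ‖θ - θstar‖ + V₀) with hm | hm <;>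
      rw [hm]
      exacts [htriv, hg]
    -- Beyond radius R the grid is not needed: 8LT ≥ 1 there, so the Cauchy–Schwarz bound √B is
    -- already below 8L√B T.
    · refine htriv.trans ?_
      gcongr
      refine le_min le_rfl ?_
      have h4 : 1 ≤ 8 * L * residualRadius B ((1 - α) / 2) b σ ‖θ - θstar‖ := by
        refine hR.trans ?_
        rw [residualRadius]
        have h6 : b * R ≤ b * ‖θ - θstar‖ := by gcongr
        gcongr
        linarith
      have h5 := mul_le_mul_of_nonneg_left h4 (Real.sqrt_nonneg B)
      linarith
  have hmin1 := min_le_left √B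
    (8 * L * √B * residualRadius B ((1 - α) / 2) b σ ‖θ - θstar‖ + V₀)
  have hmin2 := min_le_right √B
    (8 * L * √B * residualRadius B ((1 - α) / 2) b σ ‖θ - θstar‖ + V₀)
  have hQX : ‖θ - θstar‖ ≤ √(‖θ - θstar‖ ^ 2 + σ ^ 2) :=
    Real.le_sqrt_of_sq_le (by nlinarith [sq_nonneg σ])
  have hQσ : σ ≤ √(‖θ - θstar‖ ^ 2 + σ ^ 2) :=
    Real.le_sqrt_of_sq_le (by nlinarith [sq_nonneg ‖θ - θstar‖])
  have hba : 1 ≤ b / a := (one_le_div ha).mpr hab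
  have hκ1 := mul_le_mul_of_nonneg_left hQσ (by positivity : 0 ≤ b / a)
  have hκ2 := le_mul_of_one_le_left hσ hba
  refine stepBound_of_norm_le hb.le hη hσ (hstep _ hbadV) ?_ ?_
  · exact slope_le_of_constants ha hb hα0 hL (Real.sqrt_nonneg _)
      (hσ.trans hQσ) hQX (hκ2.trans hκ1) hV₀' hc hmin2
  · refine (mul_le_mul_of_nonneg_right ?_ hσ).trans (hη3.trans
      (mul_le_mul_of_nonneg_right (Real.sqrt_le_sqrt ?_) hσ))
    · gcongr
    · gcongr
      linarith

theorem measure_not_le_add {Ω : Type*} [MeasurableSpace Ω] {μ : Measure Ω} {p q q' : Ω → Prop}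
    {x y : ENNReal} (h : ∀ w, q w → q' w → p w) (hq : μ {w | ¬ q w} ≤ x)
    (hq' : μ {w | ¬ q' w} ≤ y) : μ {w | ¬ p w} ≤ x + y := by
  refine (measure_mono fun w hw => ?_).trans ((measure_union_le _ _).trans (add_le_add hq hq'))
  by_contra hc
  simp only [Set.mem_union, Set.mem_ofPred_eq, not_or, not_not] at hc
  exact hw (h w hc.1 hc.2)

/-- With N = Mn and d ≤ n, the factors √d and √n in the grid error multiply to at most n, which N
cancels. Hence M can be fixed independently of n and d. -/
theorem grid_precision {B C R ν b : ℝ} {M : ℕ} (hB : 0 ≤ B) (hC : 0 ≤ C) (hR : 0 ≤ R) (hb : 0 ≤ b)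
    (hn : 0 < n) (hdn : d ≤ n) (hM : (2 : ℝ) ≤ M) (hMν : b * (C + √B) * R ≤ M * ν) :
    √d * (1 / (M * n : ℕ)) ≤ 1 / 2 ∧ b * (C + √(B * n)) * (√d * (R / (M * n : ℕ))) ≤ ν := by
  have hn' : (0 : ℝ) < n := by exact_mod_cast hn
  have hM0 : (0 : ℝ) < M := by linarith
  have hsd : √(d : ℝ) ≤ √n := Real.sqrt_le_sqrt (by exact_mod_cast hdn)
  have hsn1 : 1 ≤ √(n : ℝ) := by
    rw [Real.one_le_sqrt]
    exact_mod_cast hn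
  have hsn : √(n : ℝ) * √n = n := Real.mul_self_sqrt hn'.le
  push_cast
  constructor
  · rw [mul_one_div, div_le_iff₀ (by positivity)]
    nlinarith
  · rw [Real.sqrt_mul hB]
    calc b * (C + √B * √n) * (√d * (R / (M * n)))
        ≤ b * (C * √n + √B * √n) * (√n * (R / (M * n))) := by
          gcongr
          exact le_mul_of_one_le_right hC hsn1
      _ = b * (C + √B) * R / M * ((√n * √n) / n) := by field_simp
      _ = b * (C + √B) * R / M := by rw [hsn, div_self hn'.ne', mul_one]
      _ ≤ ν := by rw [div_le_iff₀ hM0]; linarith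

theorem measure_not_stepBound_le {Ω : Type*} [MeasurableSpace Ω]
    {μ : Measure Ω} [IsProbabilityMeasure μ] {r e : Fin n → Ω → ℝ} {σ : ℝ≥0}
    {c₀ A B α ε η L R δ ν c V₀ C D : ℝ} {N : ℕ}
    (hA : 0 < A) (hB : 0 < B) (hc₀ : 0 < c₀)
    (hα : c₀ ≤ α) (hα1 : α < 1) (hε1 : 2 * ε ≤ 1 - α)
    (hε2 : 4 * ε * B ≤ (1 - α) * (A ^ 2 / B)) (hn : 0 < n) (hreg : IsRegular c₀ A B phi)
    (hclean : 1 - ε < cleanFraction Sstar) (hl : IsLink a b link) (ha : 0 < a) (hab : a ≤ b)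
    (hD : D = A ^ 2 / B / 2) (hC : C = √((2 * B + 18) / ((1 - α) / 2)))
    (hη : 0 ≤ η) (hη1 : 4 * η / α * (b ^ 4 * B ^ 2) ≤ a ^ 2 * D)
    (hη2 : 4 * η / α * (a ^ 2 * D) ≤ 1)
    (hη3 : η * (4 / α * (√(9 * B) + C * √B)) * σ ≤ √(c * σ) * σ)
    (hL : 0 ≤ L) (hδ : 0 ≤ δ) (hν : 0 ≤ ν) (hV₀0 : 0 ≤ V₀)
    (hV₀ : 16 * L * √B * ν + 2 * δ = V₀) (hV₀' : 4 / α * C * b ^ 2 * V₀ ≤ a ^ 2 * D / 2)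
    (hc : (a + 1) * (32 / α * C ^ 2 * L * √B) ≤ D / 2 * c) (hc0 : 0 ≤ c)
    (hR0 : 0 < R) (hR : 1 ≤ 8 * L * (C * (b * R))) (hN : 0 < N)
    (hN1 : √d * (1 / N) ≤ 1 / 2) (hNν : b * (C + √(B * n)) * (√d * (R / N)) ≤ ν)
    (hnoise : IsNoise σ e μ) (hout : IsRandomOutput L Sstar r e μ) :
    μ {w | ¬ ∀ (θ : EuclideanSpace ℝ (Fin d)) (S : Finset (Fin n)),
        IsTrimmedSet link phi
          (output link phi Sstar θstar (fun i => r i w) (fun i => e i w)) α θ S →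
        StepBound phi (D / 2) 1 a b η σ
          (c * (b / a * √(‖θ - θstar‖ ^ 2 + (σ : ℝ) ^ 2))) θstar θ
          (modelUpdate link phi
            (output link phi Sstar θstar (fun i => r i w) (fun i => e i w)) η S θ)} ≤
      ENNReal.ofReal (96 / n + ((2 * N + 1 : ℕ) : ℝ) ^ (2 * d) *
        Real.exp (-(δ ^ 2 / (2 * B) * n))) := by
  have hb : 0 < b := ha.trans_le hab
  have hgrid := measure_uniform_indicator_bound hn hL hB hδ hnoise hout
    (hreg.sum_sq_le (hα.trans hα1.le))
    (v := fun (g : Fin d → Fin (2 * N + 1)) i =>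
      link (inner ℝ (phi i) (θstar + gridPoint N R g)))
    (t := fun g => residualRadius B ((1 - α) / 2) b σ ‖gridPoint N R g‖ + ν)
    (fun g => add_nonneg (residualRadius_nonneg hb.le σ.coe_nonneg (norm_nonneg _)) hν)
    (gridPoint (d := d) N 1)
  have hcard : (Fintype.card (Fin d → Fin (2 * N + 1)) : ℝ) *
      Fintype.card (Fin d → Fin (2 * N + 1)) = ((2 * N + 1 : ℕ) : ℝ) ^ (2 * d) := by
    rw [Fintype.card_fun, Fintype.card_fin, Fintype.card_fin]
    push_cast
    ring
  rw [hcard] at hgrid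
  rw [ENNReal.ofReal_add (by positivity) (by positivity)]
  refine measure_not_le_add (fun w he hev θ S hS => ?_) (hnoise.measure_sum_sq_gt_le hn) hgrid
  exact stepBound_of_grid hA hB hc₀ hα hα1 hε1 hε2 hn hreg hclean hl ha hab hD hC hη hη1 hη2
    σ.coe_nonneg hη3 he hL hδ hV₀0 hV₀ hV₀' hc hc0 hR0 hR hN hev hN1 hNν hS

/-- One round with random outputs of the bad samples. -/
theorem random_outputs_step {c₀ A B α ε : ℝ} (hc₀ : 0 < c₀) (hA : 0 < A) (hB : 0 < B)
    (hα : c₀ ≤ α) (hα1 : α < 1) (hε1 : 2 * ε ≤ 1 - α)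
    (hε2 : 4 * ε * B ≤ (1 - α) * (A ^ 2 / B)) {L a : ℝ} (hL : 0 < L) (ha : 0 < a) :
    ∃ c : ℝ, 0 < c ∧ ∀ b : ℝ, a ≤ b → ∃ K : ℝ, 0 < K ∧ ∀ σ : ℝ≥0, ∃ η₀ : ℝ, 0 < η₀ ∧
      ∀ n d : ℕ, 0 < n → K * (d * Real.log d) ≤ n →
      ∀ phi : Fin n → EuclideanSpace ℝ (Fin d), IsRegular c₀ A B phi →
      ∀ Sstar : Finset (Fin n), 1 - ε < cleanFraction Sstar →
      ∀ link : ℝ → ℝ, IsLink a b link →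
      ∀ (θstar : EuclideanSpace ℝ (Fin d)) (η : ℝ), 0 < η → η ≤ η₀ →
      ∀ (Ω : Type*) [MeasurableSpace Ω] (μ : Measure Ω) [IsProbabilityMeasure μ]
        (e r : Fin n → Ω → ℝ), IsNoise σ e μ → IsRandomOutput L Sstar r e μ →
      μ {w | ¬ ∀ (θ : EuclideanSpace ℝ (Fin d)) (S : Finset (Fin n)),
          IsTrimmedSet link phi
            (output link phi Sstar θstar (fun i => r i w) (fun i => e i w)) α θ S →
          StepBound phi (A ^ 2 / B / 2 / 2) 1 a b η σ
            (c * (b / a * √(‖θ - θstar‖ ^ 2 + (σ : ℝ) ^ 2))) θstar θ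
            (modelUpdate link phi
              (output link phi Sstar θstar (fun i => r i w) (fun i => e i w)) η S θ)}
        ≤ ENNReal.ofReal (K / n) := by
  have hα0 : 0 < α := hc₀.trans_le hα
  have h1α : 0 < 1 - α := by linarith
  set D := A ^ 2 / B / 2 with hD
  have hD0 : 0 < D := by positivity
  set C := √((2 * B + 18) / ((1 - α) / 2)) with hC
  have hC0 : 0 < C := Real.sqrt_pos.mpr (by positivity)
  have hsB : 0 < √B := Real.sqrt_pos.mpr hB
  set c := (a + 1) * (64 * C ^ 2 * L * √B / (α * D)) with hc
  have hc0 : 0 < c := by positivity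
  refine ⟨c, hc0, fun b hab => ?_⟩
  have hb : 0 < b := ha.trans_le hab
  -- V₀ is the largest constant error the spare contraction allows; ν and δ each use half of it. R
  -- is the radius at which 8LCbR = 1.
  set V₀ := α * a ^ 2 * D / (8 * C * b ^ 2) with hV₀
  have hV₀0 : 0 < V₀ := by positivity
  set ν := V₀ / (32 * L * √B) with hν
  have hν0 : 0 < ν := by positivity
  set δ := V₀ / 4 with hδ
  have hδ0 : 0 < δ := by positivity
  set R := 1 / (8 * L * C * b) with hR
  have hR0 : 0 < R := by positivity
  obtain ⟨M, hM⟩ := exists_nat_ge (max 2 (b * (C + √B) * R / ν))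
  have hM2 : (2 : ℝ) ≤ M := (le_max_left _ _).trans hM
  have hMν : b * (C + √B) * R / ν ≤ M := (le_max_right _ _).trans hM
  obtain ⟨K, hK0, hK⟩ := exists_forall_card_mul_exp_le M (g := δ ^ 2 / (2 * B)) (by positivity)
  refine ⟨96 + K, by positivity, fun σ => ?_⟩
  obtain ⟨η₀, hη₀, hη₀'⟩ := exists_step_size (x₁ := 4 / α * (b ^ 4 * B ^ 2))
    (x₂ := 4 / α * (a ^ 2 * D)) (x₃ := 4 / α * (√(9 * B) + C * √B))
    -- The noise must fit under √κ ≥ √(cσ), so η₀ depends on σ. For σ = 0 the condition is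
    -- multiplied by σ, and any positive value serves.
    (y₁ := a ^ 2 * D) (y₂ := 1) (y₃ := if σ = 0 then 1 else √(c * σ)) (by positivity)
    (by positivity) (by positivity) (by positivity) one_pos (by
      split_ifs with h
      · exact one_pos
      · have : 0 < σ := pos_iff_ne_zero.mpr h
        positivity)
  refine ⟨η₀, hη₀, fun n d hn hnd phi hreg Sstar hclean link hl θstar η hη hηle Ω _ μ _ e r hnoise
    hout => ?_⟩
  have hn' : (0 : ℝ) < n := by exact_mod_cast hn
  -- For small n the claimed probability bound exceeds 1.
  rcases lt_or_ge (n : ℝ) (96 + K) with hlt | hge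
  · refine prob_le_one.trans ?_
    rw [ENNReal.one_le_ofReal, le_div_iff₀ hn']
    linarith
  have hdlog : 0 ≤ (d : ℝ) * Real.log d :=
    mul_nonneg (Nat.cast_nonneg d) (Real.log_natCast_nonneg d)
  obtain ⟨hdn, hcount⟩ := hK n d (by linarith) (le_trans (by nlinarith) hnd)
  have hM0 : 0 < M := by exact_mod_cast (by linarith : (0 : ℝ) < M)
  obtain ⟨hN1, hNν⟩ := grid_precision hB.le hC0.le hR0.le hb.le hn hdn hM2
    ((div_le_iff₀ hν0).mp hMν)
  obtain ⟨h1, h2, h3⟩ := hη₀' η hη hηle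
  refine (measure_not_stepBound_le (ε := ε) (V₀ := V₀) (R := R) (ν := ν) (δ := δ) (N := M * n)
    hA hB hc₀ hα hα1 hε1 hε2 hn hreg hclean hl ha hab
    hD hC hη.le (le_trans (le_of_eq (by ring)) h1) (le_trans (le_of_eq (by ring)) h2)
    ?_ hL.le hδ0.le hν0.le hV₀0.le ?_ ?_ ?_ hc0.le hR0 ?_ (Nat.mul_pos hM0 hn) hN1 hNν hnoise
    hout).trans (ENNReal.ofReal_le_ofReal (by rw [add_div]; gcongr))
  · by_cases hσ : σ = 0
    · simp [hσ]
    rw [if_neg hσ] at h3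
    exact mul_le_mul_of_nonneg_right h3 σ.coe_nonneg
  · rw [hν, hδ]
    field_simp
    ring
  · rw [hV₀]
    refine le_of_eq ?_
    field_simp
    ring
  · rw [hc]
    refine le_of_eq ?_
    field_simp
    ring
  · rw [hR]
    refine le_of_eq ?_
    field_simp

end ITLM

/-! ### Choice of the threshold and conclusion. -/

theorem theorem9 (c₀ A B α : ℝ) (hc₀ : 0 < c₀) (hA : 0 < A) (hB : 0 < B)
    (hα : c₀ ≤ α) (hα1 : α < 1) :
    ∃ c_th : ℝ, c_th < 1 ∧ ∃ c₁ : ℝ, 0 < c₁ ∧ ∃ c₂ : ℝ, 0 < c₂ ∧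
      -- arbitrary outputs of the bad samples
      (∃ K : ℝ, 0 < K ∧ ∀ a b : ℝ, 0 < a → a ≤ b → ∃ η₀ : ℝ, 0 < η₀ ∧
        ∀ (σ : ℝ≥0) (n d : ℕ), 0 < n → K * (d * Real.log d) ≤ n →
        ∀ phi : Fin n → EuclideanSpace ℝ (Fin d), ITLM.IsRegular c₀ A B phi →
        ∀ Sstar : Finset (Fin n),
          α < ITLM.cleanFraction Sstar → c_th < ITLM.cleanFraction Sstar →
        ∀ link : ℝ → ℝ, ITLM.IsLink a b link →
        ∀ (θstar : EuclideanSpace ℝ (Fin d)) (η : ℝ), 0 < η → η ≤ η₀ →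
        ∀ (Ω : Type*) [MeasurableSpace Ω] (μ : Measure Ω) [IsProbabilityMeasure μ]
          (e : Fin n → Ω → ℝ), ITLM.IsNoise σ e μ →
        μ {w | ¬ ∀ (r : Fin n → ℝ) (θ : EuclideanSpace ℝ (Fin d)) (S : Finset (Fin n)),
            ITLM.IsTrimmedSet link phi
              (ITLM.output link phi Sstar θstar r (fun i => e i w)) α θ S →
            ∃ κ : ℝ, 0 ≤ κ ∧ κ ≤ 1 / 2 ∧
              ITLM.StepBound phi c₁ c₂ a b η σ κ θstar θ
                (ITLM.modelUpdate link phi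
                  (ITLM.output link phi Sstar θstar r (fun i => e i w)) η S θ)}
          ≤ ENNReal.ofReal (K / n)) ∧
      -- random outputs of the bad samples
      (∀ L a : ℝ, 0 < L → 0 < a → ∃ c : ℝ, 0 < c ∧
        ∀ b : ℝ, a ≤ b → ∃ K : ℝ, 0 < K ∧ ∀ σ : ℝ≥0, ∃ η₀ : ℝ, 0 < η₀ ∧
        ∀ n d : ℕ, 0 < n → K * (d * Real.log d) ≤ n →
        ∀ phi : Fin n → EuclideanSpace ℝ (Fin d), ITLM.IsRegular c₀ A B phi →
        ∀ Sstar : Finset (Fin n),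
          α < ITLM.cleanFraction Sstar → c_th < ITLM.cleanFraction Sstar →
        ∀ link : ℝ → ℝ, ITLM.IsLink a b link →
        ∀ (θstar : EuclideanSpace ℝ (Fin d)) (η : ℝ), 0 < η → η ≤ η₀ →
        ∀ (Ω : Type*) [MeasurableSpace Ω] (μ : Measure Ω) [IsProbabilityMeasure μ]
          (e r : Fin n → Ω → ℝ), ITLM.IsNoise σ e μ → ITLM.IsRandomOutput L Sstar r e μ →
        μ {w | ¬ ∀ (θ : EuclideanSpace ℝ (Fin d)) (S : Finset (Fin n)),
            ITLM.IsTrimmedSet link phi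
              (ITLM.output link phi Sstar θstar (fun i => r i w) (fun i => e i w)) α θ S →
            ∃ κ : ℝ, 0 ≤ κ ∧
              κ ≤ c * max (b / a * √(‖θ - θstar‖ ^ 2 + (σ : ℝ) ^ 2)) (Real.log n / n) ∧
              ITLM.StepBound phi c₁ c₂ a b η σ κ θstar θ
                (ITLM.modelUpdate link phi
                  (ITLM.output link phi Sstar θstar (fun i => r i w) (fun i => e i w)) η S θ)}
          ≤ ENNReal.ofReal (K / n)) := by
  have h1α : 0 < 1 - α := by linarith
  have hα0 : 0 < α := hc₀.trans_le hα
  set C := √((2 * B + 18) / ((1 - α) / 2)) with hC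
  have hC0 : 0 < C := Real.sqrt_pos.mpr (by positivity)
  -- The three bounds on the bad fraction ε ensure, in turn, that (1 - α)n/2 clean samples stay
  -- unselected, that the quadratic form survives removing bad samples, and that arbitrary outputs
  -- cost at most κ = 1/2.
  obtain ⟨ε, hε0, hε⟩ : ∃ ε : ℝ, 0 < ε ∧ ε ≤ (1 - α) / 2 ∧ ε ≤ (1 - α) * (A ^ 2 / B) / (4 * B) ∧
      ε ≤ (α * (A ^ 2 / B / 2) / (16 * C)) ^ 2 / B :=
    ⟨min ((1 - α) / 2) (min ((1 - α) * (A ^ 2 / B) / (4 * B))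
      ((α * (A ^ 2 / B / 2) / (16 * C)) ^ 2 / B)), by positivity, min_le_left _ _,
      (min_le_right _ _).trans (min_le_left _ _), (min_le_right _ _).trans (min_le_right _ _)⟩
  obtain ⟨hε1, hε2, hε3⟩ := hε
  rw [le_div_iff₀ (by positivity)] at hε2 hε3
  have hε3' : 16 * C * √(ε * B) ≤ α * (A ^ 2 / B / 2) := by
    have h1 : √(ε * B) ≤ α * (A ^ 2 / B / 2) / (16 * C) :=
      Real.sqrt_le_iff.mpr ⟨by positivity, hε3⟩
    rw [le_div_iff₀ (by positivity)] at h1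
    linarith
  refine ⟨1 - ε, by linarith, A ^ 2 / B / 2 / 2, by positivity, 1, one_pos,
    ⟨96, by norm_num, fun a b ha hab => ?_⟩, fun L a hL ha => ?_⟩
  · obtain ⟨η₀, hη₀, h⟩ := ITLM.arbitrary_outputs_step hc₀ hA hB hα hα1 hε0.le (by linarith)
      (by linarith) hε3' ha hab
    refine ⟨η₀, hη₀, fun σ n d hn _ phi hreg Sstar _ hclean link hl θstar η hη hηle Ω _ μ _ e
      hnoise => ?_⟩
    refine (measure_mono fun w hw => ?_).trans (hnoise.measure_sum_sq_gt_le hn)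
    refine fun he => hw fun r θ S hS => ⟨1 / 2, by norm_num, le_rfl, ?_⟩
    exact h σ n d hn phi hreg Sstar hclean link hl θstar η hη hηle _ he r θ S hS
  · obtain ⟨c, hc, h⟩ := ITLM.random_outputs_step hc₀ hA hB hα hα1 (ε := ε) (by linarith)
      (by linarith) hL ha
    refine ⟨c, hc, fun b hab => ?_⟩
    obtain ⟨K, hK, h⟩ := h b hab
    refine ⟨K, hK, fun σ => ?_⟩
    obtain ⟨η₀, hη₀, h⟩ := h σ
    refine ⟨η₀, hη₀, fun n d hn hnd phi hreg Sstar _ hclean link hl θstar η hη hηle Ω _ μ _ e r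
      hnoise hout => ?_⟩
    refine (measure_mono fun w hw => ?_).trans
      (h n d hn hnd phi hreg Sstar hclean link hl θstar η hη hηle Ω μ e r hnoise hout)
    refine fun hstep => hw fun θ S hS => ⟨_, ?_, ?_, hstep θ S hS⟩
    · have := ha.trans_le hab
      positivity
    · exact mul_le_mul_of_nonneg_left (le_max_left _ _) hc.le
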